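/- \textbf{Setting.} An access point serves $N$ clients in slots $t=1,2,\dots$. The joint channel state $C(t)$ is an irreducible (hence positive-recurrent) Markov chain on a finite set, Markov with respect to the system history $(\mathcal H^t)$, with an arbitrary initial law; whether the channel of client $i$ is ON in slot $t$ is a function of $C(t)$. For $S\subseteq\{1,\dots,N\}$ let $X_S(t)\in\{0,1\}$ indicate that at least one client of $S$ has an ON channel in slot $t$. Let $m_S$ be the almost sure limit of $\frac1T\sum_{t=1}^T X_S(t)$, and let $v_S^2$ be the second moment of the limit in distribution of $\frac{1}{\sqrt T}\bigl(\sum_{t=1}^T X_S(t)-Tm_S\bigr)$ as $T\to\infty$. Let $(\mu_i,\sigma_i^2)_{1\le i\le N}$ be real numbers. Let $Z_i(t)\in\{0,1\}$ indicate that client $i$ receives a packet in slot $t$, and let $d_i(t)=t\mu_i-\sum_{\tau=1}^t Z_i(\tau)$. The variance-weighted-deficit (VWD) policy transmits, in each slot $t$ in which some channel is ON, exactly one packet, to a client with the largest $d_i(t-1)/\sqrt{\sigma_i^2}$ among the clients with ON channels (ties are broken in any way that depends only on the history up to slot $t$); in other slots nothing is transmitted. \textbf{Theorem.} Assume that $$\sum_{i\in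 S}\mu_i<m_S\quad\text{for all } \emptyset\neq S\subsetneq\{1,\dots,N\},\qquad \sum_{i=1}^N\mu_i=m_{\{1,\dots,N\}},$$ $$\sum_{i=1}^N\sqrt{\sigma_i^2}\ \ge\ \sqrt{v_{\{1,\dots,N\}}^2},\qquad \mu_i\ge 0,\ \ \sigma_i^2>0\quad\text{for all } i.$$ Then, under the VWD policy, for every client $i$, $\frac1T\sum_{t=1}^T Z_i(t)\to\mu_i$ almost surely as $T\to\infty$, and $\frac{1}{\sqrt T}\bigl(\sum_{t=1}^T Z_i(t)-T\mu_i\bigr)$ converges in distribution to a random variable $\hat Z_i$ with $E[\hat Z_i^2]\le\sigma_i^2$. -/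

import Mathlib

open MeasureTheory ProbabilityTheory Filter Topology

namespace Wireless

noncomputable section

/-! ### First and second order models of a random sequence -/

/-- `m` is the (long-run) mean of the sequence `Y 1, Y 2, …`: almost surely
`(Y 1 + … + Y T) / T → m`. -/
def HasTemporalMean {Ω : Type*} [MeasurableSpace Ω] (P : Measure Ω)
    (Y : ℕ → Ω → ℝ) (m : ℝ) : Prop :=
  ∀ᵐ ω ∂P, Tendsto (fun T : ℕ => (∑ t ∈ Finset.Icc 1 T, Y t ω) / (T : ℝ)) atTop (𝓝 m)

/-- `v` is the temporal variance of the sequence `Y 1, Y 2, …` centred at `m`: as `T → ∞`,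
`(Y 1 + … + Y T - T m) / √T` converges in distribution to a law with finite second moment `v`. -/
def HasTemporalVariance {Ω : Type*} [MeasurableSpace Ω] (P : Measure Ω) [IsProbabilityMeasure P]
    (Y : ℕ → Ω → ℝ) (m v : ℝ) : Prop :=
  ∃ (ν : Measure ℝ) (_ : IsProbabilityMeasure ν),
    TendstoInDistribution
      (fun (T : ℕ) (ω : Ω) => ((∑ t ∈ Finset.Icc 1 T, Y t ω) - (T : ℝ) * m) / Real.sqrt (T : ℝ))
      atTop (id : ℝ → ℝ) (fun _ => P) ν ∧
    Integrable (fun x : ℝ => x ^ 2) ν ∧ ∫ x, x ^ 2 ∂ν = v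

/-- The mean of a sequence (an arbitrary real number if there is none). -/
def temporalMean {Ω : Type*} [MeasurableSpace Ω] (P : Measure Ω) (Y : ℕ → Ω → ℝ) : ℝ :=
  Classical.epsilon fun m => HasTemporalMean P Y m

/-- The temporal variance of a sequence (an arbitrary real number if there is none). -/
def temporalVariance {Ω : Type*} [MeasurableSpace Ω] (P : Measure Ω) [IsProbabilityMeasure P]
    (Y : ℕ → Ω → ℝ) : ℝ :=
  Classical.epsilon fun v => HasTemporalVariance P Y (temporalMean P Y) v

/-- The mean is unique, so `temporalMean` is the mean whenever there is one. -/
theorem HasTemporalMean.temporalMean_eq {Ω : Type*} [MeasurableSpace Ω] {P : Measure Ω}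
    [IsProbabilityMeasure P] {Y : ℕ → Ω → ℝ} {m : ℝ} (h : HasTemporalMean P Y m) :
    temporalMean P Y = m := by
  have h' : HasTemporalMean P Y (temporalMean P Y) :=
    Classical.epsilon_spec (p := fun m => HasTemporalMean P Y m) ⟨m, h⟩
  obtain ⟨ω, h1, h2⟩ := (h'.and h).exists
  exact tendsto_nhds_unique h1 h2

/-- The temporal variance is unique, so `temporalVariance` is the temporal variance whenever
there is one. -/
theorem HasTemporalVariance.temporalVariance_eq {Ω : Type*} [MeasurableSpace Ω] {P : Measure Ω}
    [IsProbabilityMeasure P] {Y : ℕ → Ω → ℝ} {v : ℝ}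
    (h : HasTemporalVariance P Y (temporalMean P Y) v) : temporalVariance P Y = v := by
  have h' : HasTemporalVariance P Y (temporalMean P Y) (temporalVariance P Y) :=
    Classical.epsilon_spec (p := fun v => HasTemporalVariance P Y (temporalMean P Y) v) ⟨v, h⟩
  obtain ⟨ν, hν, h1, -, h2⟩ := h
  obtain ⟨ν', hν', h1', -, h2'⟩ := h'
  have key := tendstoInDistribution_unique _ h1 h1'
  simp only [Measure.map_id] at key
  rw [← h2, ← h2', key]

/-! ### Channels -/

/-- `C 1, C 2, …` is an irreducible (hence positive recurrent) Markov chain on the finite set `E`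
with transition matrix `Q`, relative to the history `ℱ` and with an arbitrary law of `C 1`.
(`C 0` plays no role.) -/
structure IsChannelChain {Ω E : Type*} [mΩ : MeasurableSpace Ω] [Fintype E] [DecidableEq E]
    (P : Measure Ω) (ℱ : Filtration ℕ mΩ) (Q : Matrix E E ℝ) (C : ℕ → Ω → E) : Prop where
  stochastic : Q ∈ Matrix.rowStochastic ℝ E
  irreducible : Q.IsIrreducible
  adapted : ∀ t : ℕ, 1 ≤ t → ∀ e : E, MeasurableSet[ℱ t] {ω | C t ω = e}
  markov : ∀ t : ℕ, 1 ≤ t → ∀ e : E,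
    P[Set.indicator {ω | C (t + 1) ω = e} (fun _ => (1 : ℝ)) | ℱ t] =ᵐ[P] fun ω => Q (C t ω) e

open Classical in
/-- `X_S(t)`: the indicator that at least one client of `S` has an ON channel in slot `t`.
The channel of client `i` is ON exactly when the channel state lies in `on i`. -/
def channelOn {Ω E : Type*} {N : ℕ} (on : Fin N → Set E) (C : ℕ → Ω → E)
    (S : Finset (Fin N)) (t : ℕ) (ω : Ω) : ℝ :=
  if ∃ i ∈ S, C t ω ∈ on i then 1 else 0

/-! ### Scheduling -/

/-- `Z_i(t)`: the indicator that client `i` receives a packet in slot `t`, where `A t` is the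
client served in slot `t`, if any. -/
def delivery {Ω : Type*} {N : ℕ} (A : ℕ → Ω → Option (Fin N)) (i : Fin N) (t : ℕ) (ω : Ω) : ℝ :=
  if A t ω = some i then 1 else 0

/-- The deficit `d_i(t) = t μ_i - (Z_i(1) + … + Z_i(t))`. -/
def deficit {Ω : Type*} {N : ℕ} (μ : Fin N → ℝ) (A : ℕ → Ω → Option (Fin N))
    (i : Fin N) (t : ℕ) (ω : Ω) : ℝ :=
  (t : ℝ) * μ i - ∑ τ ∈ Finset.Icc 1 t, delivery A i τ ω

/-- `A` follows the variance-weighted-deficit policy with parameters `μ` and `σsq` (the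
variances): in every slot `t + 1` a client is served if some channel is ON, and a client that is
served has an ON channel and the largest `d_i(t) / √σsq_i` among all clients with ON channels.
Ties may be broken in any way that depends only on the history. -/
structure IsVWD {Ω E : Type*} [mΩ : MeasurableSpace Ω] {N : ℕ} (ℱ : Filtration ℕ mΩ)
    (on : Fin N → Set E) (C : ℕ → Ω → E) (μ σsq : Fin N → ℝ)
    (A : ℕ → Ω → Option (Fin N)) : Prop where
  adapted : ∀ t : ℕ, 1 ≤ t → ∀ i : Fin N, MeasurableSet[ℱ t] {ω | A t ω = some i}
  serves : ∀ (t : ℕ) (ω : Ω), (∃ j, C (t + 1) ω ∈ on j) → ∃ i, A (t + 1) ω = some i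
  isOn : ∀ (t : ℕ) (ω : Ω) (i : Fin N), A (t + 1) ω = some i → C (t + 1) ω ∈ on i
  largest : ∀ (t : ℕ) (ω : Ω) (i : Fin N), A (t + 1) ω = some i →
    ∀ j, C (t + 1) ω ∈ on j →
      deficit μ A j t ω / Real.sqrt (σsq j) ≤ deficit μ A i t ω / Real.sqrt (σsq i)

end

end Wireless

/-!
Write `w_i = √σsq_i`, `W = ∑ w_i`, and let `x_i(t)` be the imbalance of client `i`: its weighted
deficit `d_i(t) / w_i` minus the common value `∑ d_j(t) / W`. A slot serves exactly one client if
some channel is ON and none otherwise, so that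
`∑_{t ≤ T} Z_i(t) - T μ_i = (w_i / W) (∑_{t ≤ T} X(t) - T m) - w_i x_i(T)`,
where `X` and `m` belong to the set of all clients (`sum_delivery_sub_eq`). Everything follows from
the claim that `x_i(T) / √T → 0` almost surely (`ae_tendsto_imbalance_div_sqrt`): the first-order
statement is then the law of large numbers for `X`, and by Slutsky's theorem the second-order limit
is `w_i / W` times that of `X`, whose second moment `(w_i / W)² v` is at most `w_i²` since `√v ≤ W`.

The collapse `x_i(T) = o(√T)` is a sample-path argument. Call a window of `K` slots good if, for
every set `S` of clients, the number of its slots in which `S` has an ON channel is within `ε K` of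
`K m_S`. Over a good window the policy acts as a max-weight rule with weights `x_i`, up to errors of
order `K`, and the strict inequalities `∑_{i ∈ S} μ_i < m_S` give the Lyapunov function `∑ w_i x_i²`
a drift of at most `-c K · (max x - min x) + O(K²)` (`sum_mul_sub_sum_top_le`, `lyapunov_add_le`). If
all windows of length `K` up to time `n` are good, this forces `x_i(n) = O(K)`
(`lyapunov_le_of_windows`). With `K = ⌈n ^ (1/4)⌉` that is `o(√n)`, and by exponential concentration
and Borel–Cantelli all those windows are good from some `n` on (`ae_eventually_window`).

The limit theorems for the chain rest on the Feynman–Kac formula (`integral_prod_mul`), which turns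
expectations of `exp (z ∑ f(C_r))` into powers of the transition operator twisted by `exp (z f)`. If
`h` and `k` solve Poisson equations (`exists_poisson`), then `1 + z h + z² k` is an eigenvector of
this operator up to an error of order `z³`, with eigenvalue `exp (z² v / 2)`. Taking
`z = i t / √T` gives the characteristic function of the Gaussian limit; the first-order vector
`1 + θ h`, with `θ` real and small, gives the Chernoff bound.
-/

namespace Wireless

/-! ### Poisson's equation on a finite irreducible chain -/

section Poisson

variable {E : Type*} [Fintype E] [DecidableEq E] {Q : Matrix E E ℝ}

/-- Maximum principle: a function that agrees with its one-step averages is constant. -/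
lemma eq_of_mulVec_eq_self (hs : Q ∈ Matrix.rowStochastic ℝ E) (hi : Q.IsIrreducible)
    {h : E → ℝ} (hh : Q.mulVec h = h) (x y : E) : h x = h y := by
  have : Nonempty E := ⟨x⟩
  obtain ⟨a, ha⟩ := Finite.exists_max h
  have key : ∀ z, h z = h a := by
    intro z
    obtain ⟨k, -, hk⟩ := (Matrix.isIrreducible_iff_exists_pow_pos hi.nonneg).1 hi a z
    have hsk : Q ^ k ∈ Matrix.rowStochastic ℝ E := pow_mem hs k
    have hpow : ∀ n : ℕ, (Q ^ n).mulVec h = h := by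
      intro n
      induction n with
      | zero => simp
      | succ n ih => rw [pow_succ, ← Matrix.mulVec_mulVec, hh, ih]
    have h0 : ∑ w, (Q ^ k) a w * (h a - h w) = 0 := by
      have h1 := congrFun (hpow k) a
      simp only [Matrix.mulVec, dotProduct] at h1
      simp only [mul_sub, Finset.sum_sub_distrib, ← Finset.sum_mul,
        Matrix.sum_row_of_mem_rowStochastic hsk, h1]
      ring
    have h2 := (Finset.sum_eq_zero_iff_of_nonneg (fun w _ =>
      mul_nonneg (Matrix.nonneg_of_mem_rowStochastic hsk) (sub_nonneg.2 (ha w)))).1 h0 z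
      (Finset.mem_univ z)
    have h3 := (mul_eq_zero.1 h2).resolve_left hk.ne'
    linarith
  rw [key x, key y]

/-- Poisson's equation, with the reward `g` collected on arrival: `c` is the long-run average of `g`
and `h` the relative value function. -/
lemma exists_poisson [Nonempty E] (hs : Q ∈ Matrix.rowStochastic ℝ E) (hi : Q.IsIrreducible)
    (g : E → ℝ) : ∃ (c : ℝ) (h : E → ℝ), ∀ x, ∑ y, Q x y * (g y + h y) = c + h x := by
  obtain ⟨x₀⟩ := ‹Nonempty E›
  have hnn : ∀ x y, 0 ≤ Q x y := fun x y => Matrix.nonneg_of_mem_rowStochastic hs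
  -- The rank-one term makes the singular operator `1 - Q` invertible.
  let T : (E → ℝ) →ₗ[ℝ] (E → ℝ) :=
    LinearMap.id - Q.mulVecLin + (LinearMap.proj x₀).smulRight (1 : E → ℝ)
  have hT : ∀ (h : E → ℝ) (x : E), T h x = h x - ∑ y, Q x y * h y + h x₀ := by
    intro h x
    simp [T, Matrix.mulVec, dotProduct]
  have hdiff : ∀ (h : E → ℝ) (x : E), h x - ∑ y, Q x y * h y = ∑ y, Q x y * (h x - h y) := by
    intro h x
    simp only [mul_sub, Finset.sum_sub_distrib, ← Finset.sum_mul,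
      Matrix.sum_row_of_mem_rowStochastic hs, one_mul]
  have hinj : Function.Injective T := by
    rw [← LinearMap.ker_eq_bot, LinearMap.ker_eq_bot']
    intro h hh
    have h1 : ∀ x, ∑ y, Q x y * (h x - h y) + h x₀ = 0 := by
      intro x
      rw [← hdiff, ← hT, hh]
      rfl
    have : Nonempty E := ⟨x₀⟩
    obtain ⟨a, ha⟩ := Finite.exists_max h
    obtain ⟨b, hb⟩ := Finite.exists_min h
    have h2 : 0 ≤ ∑ y, Q a y * (h a - h y) :=
      Finset.sum_nonneg fun y _ => mul_nonneg (hnn _ _) (sub_nonneg.2 (ha y))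
    have h3 : ∑ y, Q b y * (h b - h y) ≤ 0 :=
      Finset.sum_nonpos fun y _ => mul_nonpos_of_nonneg_of_nonpos (hnn _ _) (sub_nonpos.2 (hb y))
    have h4 : h x₀ = 0 := by
      have := h1 a
      have := h1 b
      linarith
    have h5 : Q.mulVec h = h := by
      ext x
      have := h1 x
      rw [← hdiff, h4] at this
      simp only [Matrix.mulVec, dotProduct]
      linarith
    ext x
    rw [eq_of_mulVec_eq_self hs hi h5 x x₀, h4]
    rfl
  obtain ⟨k, hk⟩ := (LinearMap.injective_iff_surjective.1 hinj) g
  refine ⟨k x₀, fun x => k x - g x, fun x => ?_⟩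
  have := congrFun hk x
  rw [hT] at this
  simp only [add_sub_cancel]
  linarith

/-- Centring `g` by the constant of its Poisson equation. -/
lemma sum_mul_sub_add_of_poisson (hs : Q ∈ Matrix.rowStochastic ℝ E) {g h : E → ℝ} {m : ℝ}
    (h1 : ∀ x, ∑ y, Q x y * (g y + h y) = m + h x) (x : E) :
    ∑ y, Q x y * ((g y - m) + h y) = h x := by
  have e : ∑ y, Q x y * ((g y - m) + h y) = ∑ y, Q x y * (g y + h y) - (∑ y, Q x y) * m := by
    rw [Finset.sum_mul, ← Finset.sum_sub_distrib]
    exact Finset.sum_congr rfl fun y _ => by ring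
  rw [e, h1, Matrix.sum_row_of_mem_rowStochastic hs]
  ring

end Poisson

/-! ### Expectations of multiplicative functionals of the chain -/

section Twisted

variable {E : Type*} [Fintype E] {𝕜 : Type*} [RCLike 𝕜]

/-- The transition operator twisted by `ψ`: `u ↦ Q (ψ u)`. Its powers compute the expectations of
products of `ψ` along the chain. -/
noncomputable def twisted (Q : Matrix E E ℝ) (ψ : E → 𝕜) : (E → 𝕜) →ₗ[𝕜] (E → 𝕜) where
  toFun u x := ∑ y, (Q x y : 𝕜) * (ψ y * u y)
  map_add' u v := by
    ext x
    simp only [Pi.add_apply, ← Finset.sum_add_distrib]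
    exact Finset.sum_congr rfl fun y _ => by ring
  map_smul' a u := by
    ext x
    simp only [Pi.smul_apply, smul_eq_mul, RingHom.id_apply, Finset.mul_sum]
    exact Finset.sum_congr rfl fun y _ => by ring

lemma twisted_apply (Q : Matrix E E ℝ) (ψ u : E → 𝕜) (x : E) :
    twisted Q ψ u x = ∑ y, (Q x y : 𝕜) * (ψ y * u y) := rfl

variable {Ω : Type*} [mΩ : MeasurableSpace Ω] [DecidableEq E]
  {P : Measure Ω} {ℱ : Filtration ℕ mΩ} {Q : Matrix E E ℝ} {C : ℕ → Ω → E}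

lemma IsChannelChain.stronglyMeasurable_comp (hC : IsChannelChain P ℱ Q C) {r t : ℕ} (hr : 1 ≤ r)
    (hrt : r ≤ t) {β : Type*} [TopologicalSpace β] (g : E → β) :
    StronglyMeasurable[ℱ t] fun ω => g (C r ω) := by
  let : MeasurableSpace E := ⊤
  let : TopologicalSpace E := ⊥
  have : DiscreteTopology E := ⟨rfl⟩
  have h1 : Measurable[ℱ t] (C r) := by
    refine @measurable_to_countable' E Ω _ _ (ℱ t) _ fun e => ?_
    exact ℱ.mono hrt _ (hC.adapted r hr e)
  have h2 : StronglyMeasurable[ℱ t] (C r) := h1.stronglyMeasurable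
  exact (continuous_of_discreteTopology (f := g)).comp_stronglyMeasurable h2

variable [IsProbabilityMeasure P]

lemma IsChannelChain.integral_mul_comp_succ (hC : IsChannelChain P ℱ Q C) {t : ℕ} (ht : 1 ≤ t)
    {F : Ω → 𝕜} (hF : StronglyMeasurable[ℱ t] F) {B : ℝ} (hB : ∀ ω, ‖F ω‖ ≤ B) (g : E → 𝕜) :
    ∫ ω, F ω * g (C (t + 1) ω) ∂P = ∫ ω, F ω * ∑ y, (Q (C t ω) y : 𝕜) * g y ∂P := by
  have hFm : AEStronglyMeasurable F P := (hF.mono (ℱ.le t)).aestronglyMeasurable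
  have hCm : ∀ r, 1 ≤ r → ∀ k : E → 𝕜, AEStronglyMeasurable (fun ω => k (C r ω)) P := fun r hr k =>
    ((hC.stronglyMeasurable_comp hr le_rfl k).mono (ℱ.le r)).aestronglyMeasurable
  have hint : ∀ r, 1 ≤ r → ∀ k : E → 𝕜, Integrable (fun ω => F ω * k (C r ω)) P := by
    intro r hr k
    obtain ⟨M, hM⟩ := (Set.finite_range fun e => ‖k e‖).bddAbove
    refine Integrable.of_bound (hFm.mul (hCm r hr k)) (B * M) (ae_of_all _ fun ω => ?_)
    rw [norm_mul]
    exact mul_le_mul (hB ω) (hM ⟨_, rfl⟩) (norm_nonneg _) ((norm_nonneg _).trans (hB ω))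
  have key : ∀ y : E, ∫ ω, F ω * (if C (t + 1) ω = y then 1 else 0) ∂P
      = ∫ ω, F ω * (Q (C t ω) y : 𝕜) ∂P := by
    intro y
    set I : Ω → ℝ := Set.indicator {ω | C (t + 1) ω = y} (fun _ => (1 : ℝ)) with hI
    have hIint : Integrable I P :=
      (integrable_const (1 : ℝ)).indicator (ℱ.le _ _ (hC.adapted (t + 1) (by omega) y))
    have h1 := condExp_stronglyMeasurable_bilin_of_bound
      (ContinuousLinearMap.lsmul ℝ ℝ : ℝ →L[ℝ] 𝕜 →L[ℝ] 𝕜).flip (ℱ.le t) hF hIint B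
      (ae_of_all P hB)
    have h2 : (fun ω => F ω * (if C (t + 1) ω = y then 1 else 0)) =
        fun ω => (ContinuousLinearMap.lsmul ℝ ℝ : ℝ →L[ℝ] 𝕜 →L[ℝ] 𝕜).flip (F ω) (I ω) := by
      ext ω
      by_cases h : C (t + 1) ω = y <;> simp [hI, h]
    rw [h2, ← integral_condExp (ℱ.le t), integral_congr_ae h1]
    refine integral_congr_ae ?_
    filter_upwards [hC.markov t ht y] with ω hω
    simp only [ContinuousLinearMap.flip_apply, ContinuousLinearMap.lsmul_apply]
    rw [hω, RCLike.real_smul_eq_coe_mul, mul_comm]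
  calc ∫ ω, F ω * g (C (t + 1) ω) ∂P
      = ∫ ω, ∑ y, F ω * (if C (t + 1) ω = y then 1 else 0) * g y ∂P := by
        congr 1
        ext ω
        simp
    _ = ∑ y, ∫ ω, F ω * (if C (t + 1) ω = y then 1 else 0) * g y ∂P :=
        integral_finsetSum _ fun y _ =>
          (hint (t + 1) (by omega) fun e => if e = y then 1 else 0).mul_const _
    _ = ∑ y, ∫ ω, F ω * (Q (C t ω) y : 𝕜) * g y ∂P := by
        simp only [integral_mul_const, key]
    _ = ∫ ω, ∑ y, F ω * (Q (C t ω) y : 𝕜) * g y ∂P :=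
        (integral_finsetSum _ fun y _ =>
          (hint t ht fun e => (Q e y : 𝕜)).mul_const _).symm
    _ = _ := by simp only [Finset.mul_sum, mul_assoc]

/-- The Feynman–Kac formula: powers of the twisted transition operator compute expectations of
multiplicative functionals over a window of slots. -/
lemma IsChannelChain.integral_prod_mul (hC : IsChannelChain P ℱ Q C) {s : ℕ} (hs : 1 ≤ s)
    {F : Ω → 𝕜} (hF : StronglyMeasurable[ℱ s] F) {B : ℝ} (hB : ∀ ω, ‖F ω‖ ≤ B) (ψ : E → 𝕜)
    (K : ℕ) (u : E → 𝕜) :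
    ∫ ω, F ω * (∏ r ∈ Finset.Ioc s (s + K), ψ (C r ω)) * u (C (s + K) ω) ∂P
      = ∫ ω, F ω * ((twisted Q ψ) ^ K) u (C s ω) ∂P := by
  induction K generalizing u with
  | zero => simp
  | succ K ih =>
    obtain ⟨M, hM⟩ := (Set.finite_range fun e => ‖ψ e‖).bddAbove
    have hm : StronglyMeasurable[ℱ (s + K)]
        fun ω => F ω * ∏ r ∈ Finset.Ioc s (s + K), ψ (C r ω) := by
      refine (hF.mono (ℱ.mono (by omega))).mul ?_
      refine Finset.stronglyMeasurable_fun_prod _ fun r hr => ?_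
      rw [Finset.mem_Ioc] at hr
      exact hC.stronglyMeasurable_comp (by omega) (by omega) ψ
    have hb : ∀ ω, ‖F ω * ∏ r ∈ Finset.Ioc s (s + K), ψ (C r ω)‖ ≤ B * M ^ K := by
      intro ω
      rw [norm_mul, norm_prod]
      refine mul_le_mul (hB ω) ?_ (Finset.prod_nonneg fun _ _ => norm_nonneg _)
        ((norm_nonneg _).trans (hB ω))
      calc ∏ r ∈ Finset.Ioc s (s + K), ‖ψ (C r ω)‖
          ≤ ∏ r ∈ Finset.Ioc s (s + K), M :=
            Finset.prod_le_prod (fun _ _ => norm_nonneg _) fun r _ => hM ⟨_, rfl⟩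
        _ = M ^ K := by simp
    rw [pow_succ, Module.End.mul_apply, ← ih]
    have := hC.integral_mul_comp_succ (t := s + K) (by omega) hm hb fun y => ψ y * u y
    rw [← add_assoc]
    simp only [← twisted_apply] at this
    rw [← this]
    congr 1
    ext ω
    rw [Finset.prod_Ioc_succ_top (by omega)]
    ring

lemma norm_twisted_apply_le (hs : Q ∈ Matrix.rowStochastic ℝ E) {ψ : E → 𝕜}
    (hψ : ∀ y, ‖ψ y‖ ≤ 1) (u : E → 𝕜) : ‖twisted Q ψ u‖ ≤ ‖u‖ := by
  refine (pi_norm_le_iff_of_nonneg (norm_nonneg _)).2 fun x => ?_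
  rw [twisted_apply]
  calc ‖∑ y, (Q x y : 𝕜) * (ψ y * u y)‖ ≤ ∑ y, ‖(Q x y : 𝕜) * (ψ y * u y)‖ := norm_sum_le _ _
    _ ≤ ∑ y, Q x y * ‖u‖ := by
        refine Finset.sum_le_sum fun y _ => ?_
        have h0 : 0 ≤ Q x y := Matrix.nonneg_of_mem_rowStochastic hs
        rw [norm_mul, norm_mul, RCLike.norm_ofReal, abs_of_nonneg h0]
        refine mul_le_mul_of_nonneg_left ?_ h0
        calc ‖ψ y‖ * ‖u y‖ ≤ 1 * ‖u‖ :=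
              mul_le_mul (hψ y) (norm_le_pi_norm u y) (norm_nonneg _) zero_le_one
          _ = ‖u‖ := one_mul _
    _ = ‖u‖ := by rw [← Finset.sum_mul, Matrix.sum_row_of_mem_rowStochastic hs, one_mul]

end Twisted

/-! ### The central limit theorem for an additive functional of the chain -/

section CentralLimit

open Complex Asymptotics

variable {E : Type*} [Fintype E] {Q : Matrix E E ℝ}

/-- Second-order perturbation of the eigenvalue `1` of `Q`: when `h` and `k` solve the two Poisson
equations, `1 + z h + z² k` is an eigenvector of the operator twisted by `exp (z f)`, of eigenvalue
`exp (z² c)`, up to an error of order `z³`. -/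
lemma isBigO_twisted_exp_sub (hQ : ∀ x, ∑ y, Q x y = 1) {f h k : E → ℝ} {c : ℝ}
    (h1 : ∀ x, ∑ y, Q x y * (f y + h y) = h x)
    (h2 : ∀ x, ∑ y, Q x y * ((f y ^ 2 / 2 + f y * h y) + k y) = c + k x) :
    (fun z : ℂ => twisted Q (fun y => exp (z * f y)) (fun y => 1 + z * h y + z ^ 2 * k y) -
      exp (z ^ 2 * c) • fun y => 1 + z * h y + z ^ 2 * k y) =O[𝓝 0] fun z => z ^ 3 := by
  refine isBigO_pi.2 fun x => ?_
  have hD : ∀ a : ℝ, (fun z : ℂ => exp (z * a) - (1 + z * a + (z * a) ^ 2 / 2)) =O[𝓝 0]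
      fun z => z ^ 3 := by
    intro a
    have h0 : Tendsto (fun z : ℂ => z * a) (𝓝 0) (𝓝 0) := by
      have : Continuous fun z : ℂ => z * a := by fun_prop
      simpa using this.tendsto 0
    have h3 := (exp_sub_sum_range_isBigO_pow 3).comp_tendsto h0
    have h4 : ((fun x : ℂ => x ^ 3) ∘ fun z : ℂ => z * a) =O[𝓝 0] fun z => z ^ 3 := by
      simp only [Function.comp_def, mul_pow]
      simp_rw [mul_comm _ ((a : ℂ) ^ 3)]
      exact isBigO_const_mul_self _ _ _
    refine (h3.trans h4).congr_left fun z => ?_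
    simp [Finset.sum_range_succ]
  have hr : (fun z : ℂ => exp (z ^ 2 * c) - (1 + z ^ 2 * c)) =O[𝓝 0] fun z => z ^ 3 := by
    have h0 : Tendsto (fun z : ℂ => z ^ 2 * c) (𝓝 0) (𝓝 0) := by
      have : Continuous fun z : ℂ => z ^ 2 * c := by fun_prop
      simpa using this.tendsto 0
    have h3 := (exp_sub_sum_range_isBigO_pow 2).comp_tendsto h0
    have h4 : ((fun x : ℂ => x ^ 2) ∘ fun z : ℂ => z ^ 2 * c) =O[𝓝 0] fun z => z ^ 3 := by
      have : ((fun x : ℂ => x ^ 2) ∘ fun z : ℂ => z ^ 2 * c) = fun z => (c : ℂ) ^ 2 * z ^ 4 := by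
        ext z
        simp only [Function.comp_def]
        ring
      rw [this]
      exact (isBigO_const_mul_self _ _ _).trans
        (isLittleO_pow_pow (show 3 < 4 by norm_num)).isBigO
    refine (h3.trans h4).congr_left fun z => ?_
    simp [Finset.sum_range_succ]
  have hbdd : ∀ p : ℂ → ℂ, Continuous p → p =O[𝓝 0] fun _ => (1 : ℂ) := fun p hp =>
    (hp.tendsto 0).isBigO_one ℂ
  have hA : (fun z : ℂ => ∑ y, (Q x y : ℂ) * ((exp (z * f y) - (1 + z * f y + (z * f y) ^ 2 / 2)) *
      (1 + z * h y + z ^ 2 * k y))) =O[𝓝 0] fun z => z ^ 3 := by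
    refine IsBigO.fun_sum fun y _ => IsBigO.const_mul_left ?_ _
    simpa using (hD (f y)).mul (hbdd (fun z => 1 + z * h y + z ^ 2 * k y) (by fun_prop))
  have hB : (fun z : ℂ => (exp (z ^ 2 * c) - (1 + z ^ 2 * c)) * (1 + z * h x + z ^ 2 * k x))
      =O[𝓝 0] fun z => z ^ 3 := by
    simpa using hr.mul (hbdd (fun z => 1 + z * h x + z ^ 2 * k x) (by fun_prop))
  have hR : (fun z : ℂ => z ^ 3 * (∑ y, (Q x y : ℂ) * (f y * k y + f y ^ 2 / 2 * h y +
      z * (f y ^ 2 / 2 * k y)) - (c * h x + z * (c * k x)))) =O[𝓝 0] fun z => z ^ 3 := by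
    simpa using (isBigO_refl (fun z : ℂ => z ^ 3) (𝓝 0)).mul (hbdd (fun z : ℂ =>
      ∑ y, (Q x y : ℂ) * (f y * k y + f y ^ 2 / 2 * h y + z * (f y ^ 2 / 2 * k y)) -
        (c * h x + z * (c * k x))) (by fun_prop))
  refine ((hA.sub hB).add hR).congr_left fun z => ?_
  have e0 : ∑ y, (Q x y : ℂ) = 1 := by exact_mod_cast congrArg (fun r : ℝ => (r : ℂ)) (hQ x)
  have e1 : ∑ y, (Q x y : ℂ) * (f y + h y) = h x := by
    exact_mod_cast congrArg (fun r : ℝ => (r : ℂ)) (h1 x)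
  have e2 : ∑ y, (Q x y : ℂ) * (((f y : ℂ) ^ 2 / 2 + f y * h y) + k y) = (c : ℂ) + k x := by
    exact_mod_cast congrArg (fun r : ℝ => (r : ℂ)) (h2 x)
  have e3 : twisted Q (fun y => exp (z * f y)) (fun y => 1 + z * h y + z ^ 2 * k y) x =
      ∑ y, (Q x y : ℂ) * ((exp (z * f y) - (1 + z * f y + (z * f y) ^ 2 / 2)) *
        (1 + z * h y + z ^ 2 * k y)) + ∑ y, (Q x y : ℂ) + z * ∑ y, (Q x y : ℂ) * (f y + h y) +
      z ^ 2 * ∑ y, (Q x y : ℂ) * (((f y : ℂ) ^ 2 / 2 + f y * h y) + k y) +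
      z ^ 3 * ∑ y, (Q x y : ℂ) * (f y * k y + f y ^ 2 / 2 * h y + z * (f y ^ 2 / 2 * k y)) := by
    simp only [twisted_apply, coe_algebraMap, Finset.mul_sum, ← Finset.sum_add_distrib]
    exact Finset.sum_congr rfl fun y _ => by ring
  rw [e0, e1, e2] at e3
  rw [Pi.sub_apply, Pi.smul_apply, smul_eq_mul, e3]
  ring

/-- Powers of a contraction along an approximate eigenvector. -/
lemma norm_pow_apply_sub_le {V : Type*} [NormedAddCommGroup V] [NormedSpace ℂ V] (L : V →ₗ[ℂ] V)
    (hL : ∀ w, ‖L w‖ ≤ ‖w‖) (u : V) (z : ℂ) {Λ : ℝ} (n : ℕ) (hz : ∀ j ≤ n, ‖z ^ j‖ ≤ Λ) :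
    ‖(L ^ n) u - z ^ n • u‖ ≤ n * (Λ * ‖L u - z • u‖) := by
  induction n with
  | zero => simp
  | succ n ih =>
    have e : (L ^ (n + 1)) u - z ^ (n + 1) • u =
        L ((L ^ n) u - z ^ n • u) + z ^ n • (L u - z • u) := by
      rw [pow_succ', Module.End.mul_apply, map_sub, map_smul, smul_sub, smul_smul, ← pow_succ]
      abel
    rw [e]
    calc ‖L ((L ^ n) u - z ^ n • u) + z ^ n • (L u - z • u)‖
        ≤ ‖L ((L ^ n) u - z ^ n • u)‖ + ‖z ^ n • (L u - z • u)‖ := norm_add_le _ _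
      _ ≤ n * (Λ * ‖L u - z • u‖) + Λ * ‖L u - z • u‖ := by
          refine add_le_add ((hL _).trans (ih fun j hj => hz j (by omega))) ?_
          rw [norm_smul]
          exact mul_le_mul_of_nonneg_right (hz n (by omega)) (norm_nonneg _)
      _ = _ := by push_cast; ring

lemma norm_pow_apply_le {V : Type*} [NormedAddCommGroup V] [NormedSpace ℂ V] (L : V →ₗ[ℂ] V)
    (hL : ∀ w, ‖L w‖ ≤ ‖w‖) (n : ℕ) (w : V) : ‖(L ^ n) w‖ ≤ ‖w‖ := by
  induction n with
  | zero => simp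
  | succ n ih => rw [pow_succ', Module.End.mul_apply]; exact (hL _).trans ih

lemma tendsto_twisted_exp_pow [DecidableEq E] (hs : Q ∈ Matrix.rowStochastic ℝ E)
    {f h k : E → ℝ} {c : ℝ}
    (h1 : ∀ x, ∑ y, Q x y * (f y + h y) = h x)
    (h2 : ∀ x, ∑ y, Q x y * ((f y ^ 2 / 2 + f y * h y) + k y) = c + k x) (t : ℝ) :
    Tendsto (fun n : ℕ => ((twisted Q
      (fun y => exp (((t / √((n + 1 : ℕ) : ℝ) : ℝ) * I) * f y))) ^ n) (1 : E → ℂ)) atTop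
      (𝓝 (exp (-(t ^ 2 * c : ℝ)) • (1 : E → ℂ))) := by
  set ε : ℕ → ℝ := fun n => t / √((n + 1 : ℕ) : ℝ) with hε
  set z : ℕ → ℂ := fun n => (ε n : ℂ) * I with hz
  set u : ℂ → E → ℂ := fun z y => 1 + z * h y + z ^ 2 * k y with hu
  set L : ℕ → (E → ℂ) →ₗ[ℂ] (E → ℂ) := fun n => twisted Q (fun y => exp (z n * f y)) with hLdef
  have hsq : ∀ n, ε n ^ 2 = t ^ 2 / (n + 1) := by
    intro n
    simp only [hε, div_pow]
    rw [Real.sq_sqrt (by positivity)]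
    push_cast
    rfl
  have hz2 : ∀ n, z n ^ 2 * c = ((-(t ^ 2 * c / (n + 1)) : ℝ) : ℂ) := by
    intro n
    simp only [hz]
    rw [mul_pow, I_sq, ← ofReal_pow, hsq]
    push_cast
    ring
  have hsqrt : Tendsto (fun n : ℕ => √((n + 1 : ℕ) : ℝ)) atTop atTop :=
    Real.tendsto_sqrt_atTop.comp (tendsto_natCast_atTop_atTop.comp (tendsto_add_atTop_nat 1))
  have hε0 : Tendsto ε atTop (𝓝 0) := tendsto_const_nhds.div_atTop hsqrt
  have hz0 : Tendsto z atTop (𝓝 0) := by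
    have : Continuous fun r : ℝ => (r : ℂ) * I := by fun_prop
    simpa [Function.comp_def, hz] using (this.tendsto 0).comp hε0
  have hL : ∀ n w, ‖L n w‖ ≤ ‖w‖ := by
    intro n w
    refine norm_twisted_apply_le hs (fun y => ?_) w
    have : z n * f y = ((ε n * f y : ℝ) : ℂ) * I := by simp only [hz]; push_cast; ring
    rw [this, norm_exp_ofReal_mul_I]
  -- The defect of the approximate eigenvector, accumulated over `n` steps, vanishes.
  have hη : Tendsto (fun n : ℕ => (n : ℝ) *
      (Real.exp (t ^ 2 * |c|) * ‖L n (u (z n)) - exp (z n ^ 2 * c) • u (z n)‖)) atTop (𝓝 0) := by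
    obtain ⟨B, hB⟩ := ((isBigO_twisted_exp_sub (Matrix.sum_row_of_mem_rowStochastic hs) h1
      h2).comp_tendsto hz0).bound
    have hlim : Tendsto (fun n : ℕ => Real.exp (t ^ 2 * |c|) * (|B| * (t ^ 2 * |ε n|))) atTop
        (𝓝 0) := by
      have := (((hε0.abs.const_mul (t ^ 2)).const_mul |B|).const_mul (Real.exp (t ^ 2 * |c|)))
      simpa using this
    refine squeeze_zero' (Eventually.of_forall fun n => by positivity) ?_ hlim
    filter_upwards [hB] with n hn
    have hnz : ‖z n ^ 3‖ = |ε n| * ε n ^ 2 := by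
      rw [norm_pow]
      simp only [hz, norm_mul, norm_I, mul_one, norm_real, Real.norm_eq_abs]
      rw [pow_succ, sq_abs, mul_comm]
    have hn1 : (n : ℝ) * ε n ^ 2 ≤ t ^ 2 := by
      rw [hsq, mul_div_assoc', div_le_iff₀ (by positivity)]
      nlinarith [sq_nonneg t]
    have hn2 : ‖L n (u (z n)) - exp (z n ^ 2 * c) • u (z n)‖ ≤ |B| * (|ε n| * ε n ^ 2) := by
      rw [← hnz]
      exact hn.trans (mul_le_mul_of_nonneg_right (le_abs_self B) (norm_nonneg _))
    calc (n : ℝ) * (Real.exp (t ^ 2 * |c|) * ‖L n (u (z n)) - exp (z n ^ 2 * c) • u (z n)‖)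
        ≤ (n : ℝ) * (Real.exp (t ^ 2 * |c|) * (|B| * (|ε n| * ε n ^ 2))) := by gcongr
      _ = Real.exp (t ^ 2 * |c|) * (|B| * (((n : ℝ) * ε n ^ 2) * |ε n|)) := by ring
      _ ≤ _ := by gcongr
  have hu1 : Tendsto (fun n => ‖u (z n) - 1‖) atTop (𝓝 0) := by
    have hcont : Continuous fun z => ‖u z - 1‖ := by
      have : Continuous u := continuous_pi fun y => by simp only [hu]; fun_prop
      fun_prop
    have h0 : ‖u 0 - 1‖ = 0 := by
      rw [norm_eq_zero]
      ext y
      simp [hu]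
    rw [← h0]
    exact (hcont.tendsto 0).comp hz0
  have hpow : ∀ n j : ℕ, j ≤ n → ‖exp (z n ^ 2 * c) ^ j‖ ≤ Real.exp (t ^ 2 * |c|) := by
    intro n j hj
    rw [hz2, norm_pow, norm_exp_ofReal, ← Real.exp_nat_mul, Real.exp_le_exp]
    have h3 : -(t ^ 2 * c / (n + 1)) ≤ t ^ 2 * |c| / (n + 1) := by
      rw [← neg_div, ← mul_neg]
      gcongr
      exact neg_le_abs c
    have h4 : (j : ℝ) ≤ n + 1 := by exact_mod_cast hj.trans (Nat.le_succ n)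
    calc (j : ℝ) * -(t ^ 2 * c / (n + 1)) ≤ (n + 1) * (t ^ 2 * |c| / (n + 1)) := by
          refine (mul_le_mul_of_nonneg_left h3 (by positivity)).trans ?_
          gcongr
      _ = t ^ 2 * |c| := by field_simp
  have hdiff : Tendsto (fun n => (L n ^ n) (1 : E → ℂ) - exp (z n ^ 2 * c) ^ n • (1 : E → ℂ))
      atTop (𝓝 0) := by
    refine squeeze_zero_norm (a := fun n : ℕ => ‖u (z n) - 1‖ + (n : ℝ) *
      (Real.exp (t ^ 2 * |c|) * ‖L n (u (z n)) - exp (z n ^ 2 * c) • u (z n)‖) +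
      Real.exp (t ^ 2 * |c|) * ‖u (z n) - 1‖) (fun n => ?_)
      (by simpa using (hu1.add hη).add (hu1.const_mul (Real.exp (t ^ 2 * |c|))))
    have e : (L n ^ n) (1 : E → ℂ) - exp (z n ^ 2 * c) ^ n • (1 : E → ℂ) =
        -(L n ^ n) (u (z n) - 1) + ((L n ^ n) (u (z n)) - exp (z n ^ 2 * c) ^ n • u (z n)) +
        exp (z n ^ 2 * c) ^ n • (u (z n) - 1) := by
      rw [map_sub, smul_sub]
      abel
    rw [e]
    refine (norm_add₃_le).trans (add_le_add_three ?_ ?_ ?_)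
    · rw [norm_neg]
      exact norm_pow_apply_le _ (hL n) _ _
    · exact norm_pow_apply_sub_le _ (hL n) _ _ n (hpow n)
    · rw [norm_smul]
      exact mul_le_mul_of_nonneg_right (hpow n n le_rfl) (norm_nonneg _)
  have hlam : Tendsto (fun n => exp (z n ^ 2 * c) ^ n • (1 : E → ℂ)) atTop
      (𝓝 (exp (-(t ^ 2 * c : ℝ)) • (1 : E → ℂ))) := by
    refine Tendsto.smul_const ?_ _
    have h3 : ∀ n : ℕ, exp (z n ^ 2 * c) ^ n =
        exp ((-(t ^ 2 * c) * ((n : ℝ) / (n + 1)) : ℝ) : ℂ) := by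
      intro n
      rw [hz2, ← exp_nat_mul]
      congr 1
      push_cast
      ring
    simp only [h3]
    have h4 := (tendsto_natCast_div_add_atTop (1 : ℝ)).const_mul (-(t ^ 2 * c))
    have h5 : Continuous fun r : ℝ => exp (r : ℂ) := by fun_prop
    simpa [Function.comp_def] using (h5.tendsto _).comp h4
  have hsum := hdiff.add hlam
  simp only [sub_add_cancel, zero_add] at hsum
  exact hsum

variable {Ω : Type*} [mΩ : MeasurableSpace Ω] [DecidableEq E]
  {P : Measure Ω} {ℱ : Filtration ℕ mΩ} {C : ℕ → Ω → E}

lemma IsChannelChain.measurable_sum (hC : IsChannelChain P ℱ Q C) (f : E → ℝ) (T : ℕ) :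
    Measurable fun ω => ∑ r ∈ Finset.Icc 1 T, f (C r ω) :=
  Finset.measurable_fun_sum _ fun r hr => ((hC.stronglyMeasurable_comp (Finset.mem_Icc.1 hr).1
    le_rfl f).mono (ℱ.le r)).measurable

variable [IsProbabilityMeasure P]

lemma IsChannelChain.tendsto_charFun (hC : IsChannelChain P ℱ Q C) {f h k : E → ℝ} {c : ℝ}
    (h1 : ∀ x, ∑ y, Q x y * (f y + h y) = h x)
    (h2 : ∀ x, ∑ y, Q x y * ((f y ^ 2 / 2 + f y * h y) + k y) = c + k x) (t : ℝ) :
    Tendsto (fun T : ℕ =>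
      charFun (P.map fun ω => (∑ r ∈ Finset.Icc 1 T, f (C r ω)) / √(T : ℝ)) t) atTop
      (𝓝 (exp (-(t ^ 2 * c : ℝ)))) := by
  rw [← tendsto_add_atTop_iff_nat 1]
  set ε : ℕ → ℝ := fun n => t / √((n + 1 : ℕ) : ℝ) with hε
  set w : ℕ → E → ℂ := fun n x => exp ((ε n * I) * f x) *
    ((twisted Q (fun y => exp ((ε n * I) * f y))) ^ n) 1 x with hw
  have hεt : Tendsto ε atTop (𝓝 0) := tendsto_const_nhds.div_atTop
    (Real.tendsto_sqrt_atTop.comp (tendsto_natCast_atTop_atTop.comp (tendsto_add_atTop_nat 1)))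
  have hwlim : Tendsto w atTop (𝓝 fun _ => exp (-(t ^ 2 * c : ℝ))) := by
    refine tendsto_pi_nhds.2 fun x => ?_
    have h3 := tendsto_pi_nhds.1 (tendsto_twisted_exp_pow hC.stochastic h1 h2 t) x
    have h4 : Continuous fun r : ℝ => exp ((r * I) * f x) := by fun_prop
    have h5 := ((h4.tendsto 0).comp hεt).mul h3
    simp only [ofReal_zero, zero_mul, exp_zero, one_mul, Pi.smul_apply, Pi.one_apply, smul_eq_mul,
      mul_one] at h5
    exact h5
  have hchar : ∀ n : ℕ, charFun (P.map fun ω =>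
      (∑ r ∈ Finset.Icc 1 (n + 1), f (C r ω)) / √((n + 1 : ℕ) : ℝ)) t = ∫ ω, w n (C 1 ω) ∂P := by
    intro n
    rw [charFun_apply_real, integral_map ((hC.measurable_sum f (n + 1)).div_const _).aemeasurable
      (by fun_prop)]
    have hF : StronglyMeasurable[ℱ 1] fun ω => exp ((ε n * I) * f (C 1 ω)) :=
      hC.stronglyMeasurable_comp le_rfl le_rfl fun y => exp ((ε n * I) * f y)
    have hFb : ∀ ω, ‖exp ((ε n * I) * f (C 1 ω))‖ ≤ 1 := by
      intro ω
      have : (ε n * I) * f (C 1 ω) = ((ε n * f (C 1 ω) : ℝ) : ℂ) * I := by push_cast; ring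
      rw [this, norm_exp_ofReal_mul_I]
    have h3 := hC.integral_prod_mul le_rfl hF hFb (fun y => exp ((ε n * I) * f y)) n 1
    simp only [Pi.one_apply, mul_one] at h3
    rw [hw, ← h3]
    congr 1
    ext ω
    rw [← exp_sum, ← exp_add, ← Finset.mul_sum, ← mul_add, add_comm 1 n]
    congr 1
    rw [← Finset.add_sum_Ioc_eq_sum_Icc (by omega : 1 ≤ n + 1)]
    simp only [hε]
    push_cast
    ring
  simp only [hchar]
  refine tendsto_iff_norm_sub_tendsto_zero.2
    (squeeze_zero (fun _ => norm_nonneg _) (fun n => ?_) (tendsto_iff_norm_sub_tendsto_zero.1 hwlim))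
  have hint : Integrable (fun ω => w n (C 1 ω)) P := by
    obtain ⟨M, hM⟩ := (Set.finite_range fun e => ‖w n e‖).bddAbove
    exact Integrable.of_bound ((hC.stronglyMeasurable_comp le_rfl le_rfl (w n)).mono
      (ℱ.le 1)).aestronglyMeasurable M (ae_of_all _ fun ω => hM ⟨_, rfl⟩)
  have h4 : ∫ ω, w n (C 1 ω) ∂P - exp (-(t ^ 2 * c : ℝ)) =
      ∫ ω, (w n (C 1 ω) - exp (-(t ^ 2 * c : ℝ))) ∂P := by
    rw [integral_sub hint (integrable_const _)]
    simp
  rw [h4]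
  refine (norm_integral_le_of_norm_le_const (ae_of_all _ fun ω => ?_)).trans_eq
    (by rw [probReal_univ, mul_one])
  exact norm_le_pi_norm (w n - fun _ => exp (-(t ^ 2 * c : ℝ))) (C 1 ω)

/-- The central limit theorem for a centred function of a finite irreducible chain. -/
theorem IsChannelChain.exists_tendstoInDistribution (hC : IsChannelChain P ℱ Q C) {f h : E → ℝ}
    (h1 : ∀ x, ∑ y, Q x y * (f y + h y) = h x) :
    ∃ v : NNReal, TendstoInDistribution
      (fun (T : ℕ) (ω : Ω) => (∑ r ∈ Finset.Icc 1 T, f (C r ω)) / √(T : ℝ))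
      atTop (id : ℝ → ℝ) (fun _ => P) (gaussianReal 0 v) := by
  obtain ⟨ω₀⟩ : Nonempty Ω := P.nonempty_of_neZero
  have : Nonempty E := ⟨C 1 ω₀⟩
  obtain ⟨c, k, h2⟩ := exists_poisson hC.stochastic hC.irreducible fun y => f y ^ 2 / 2 + f y * h y
  have hlim := hC.tendsto_charFun h1 h2
  have hmeas : ∀ T : ℕ, AEMeasurable
      (fun ω => (∑ r ∈ Finset.Icc 1 T, f (C r ω)) / √(T : ℝ)) P :=
    fun T => ((hC.measurable_sum f T).div_const _).aemeasurable
  -- A limit of characteristic functions is bounded by one, so that `c` is a half variance.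
  have hc : 0 ≤ c := by
    have h3 := le_of_tendsto (hlim 1).norm (Eventually.of_forall fun T => by
      have := Measure.isProbabilityMeasure_map (hmeas T)
      exact norm_charFun_le_one _)
    rw [← ofReal_neg, norm_exp_ofReal, Real.exp_le_one_iff] at h3
    linarith
  let v : NNReal := ⟨2 * c, by positivity⟩
  refine ⟨v, hmeas, by fun_prop, ?_⟩
  refine ProbabilityMeasure.tendsto_iff_tendsto_charFun.2 fun t => ?_
  have h3 : charFun ((gaussianReal 0 v).map id) t =
      exp (-(t ^ 2 * c : ℝ)) := by
    rw [Measure.map_id, charFun_gaussianReal, show ((v : ℝ) : ℂ) = ((2 * c : ℝ) : ℂ) from rfl]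
    congr 1
    push_cast
    ring
  simp only [ProbabilityMeasure.coe_mk]
  rw [h3]
  exact hlim t

end CentralLimit

/-! ### Exponential concentration over windows of slots -/

section Concentration

variable {Ω E : Type*} [mΩ : MeasurableSpace Ω] [Fintype E] [DecidableEq E]
  {P : Measure Ω} {ℱ : Filtration ℕ mΩ} {Q : Matrix E E ℝ} {C : ℕ → Ω → E}

/-- The solution `h` of Poisson's equation makes `1 + θ h` a subeigenvector of the operator twisted
by `exp (θ f)`, of eigenvalue `exp (O(θ²))`. -/
lemma twisted_exp_pow_le (hs : Q ∈ Matrix.rowStochastic ℝ E) {f h : E → ℝ}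
    (h1 : ∀ x, ∑ y, Q x y * (f y + h y) = h x) {B θ : ℝ} (hθ : 0 ≤ θ) (hθB : θ * B ≤ 1 / 2)
    (hf : ∀ x, |f x| ≤ B) (hh : ∀ x, |h x| ≤ B) (K : ℕ) (x : E) :
    ((twisted Q fun y => Real.exp (θ * f y)) ^ K) (fun y => 1 + θ * h y) x ≤
      Real.exp (6 * B ^ 2 * θ ^ 2 * K) * (1 + θ * h x) := by
  have hnn : ∀ x y, 0 ≤ Q x y := fun x y => Matrix.nonneg_of_mem_rowStochastic hs
  have hθa : ∀ a : ℝ, |a| ≤ B → |θ * a| ≤ 1 / 2 := by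
    intro a ha
    rw [abs_mul, abs_of_nonneg hθ]
    exact (mul_le_mul_of_nonneg_left ha hθ).trans hθB
  have hu : ∀ y, 1 / 2 ≤ 1 + θ * h y := fun y => by
    have := (abs_le.1 (hθa _ (hh y))).1
    linarith
  induction K generalizing x with
  | zero => simp
  | succ K ih =>
    have hB0 : 0 ≤ B := (abs_nonneg _).trans (hf x)
    rw [pow_succ', Module.End.mul_apply, twisted_apply]
    simp only [RCLike.ofReal_real_eq_id, id_eq]
    have hstep : ∑ y, Q x y * (Real.exp (θ * f y) * (1 + θ * h y)) ≤
        Real.exp (6 * B ^ 2 * θ ^ 2) * (1 + θ * h x) := by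
      have hy : ∀ y, Real.exp (θ * f y) * (1 + θ * h y) ≤
          1 + θ * (f y + h y) + 3 * B ^ 2 * θ ^ 2 := by
        intro y
        have ha := hθa _ (hf y)
        have hexp : Real.exp (θ * f y) ≤ 1 + θ * f y + (θ * f y) ^ 2 := by
          have := (abs_le.1 (Real.abs_exp_sub_one_sub_id_le (ha.trans (by norm_num)))).2
          linarith
        have hfh : f y * h y ≤ B ^ 2 := by
          refine (le_abs_self _).trans ?_
          rw [abs_mul, sq]
          exact mul_le_mul (hf y) (hh y) (abs_nonneg _) hB0
        have hff : f y ^ 2 ≤ B ^ 2 := sq_le_sq' (abs_le.1 (hf y)).1 (abs_le.1 (hf y)).2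
        have h3 : f y ^ 2 * (θ * h y) ≤ B ^ 2 * 1 := by
          have := (abs_le.1 (hθa _ (hh y))).2
          exact (mul_le_mul_of_nonneg_left (this.trans (by norm_num)) (sq_nonneg _)).trans
            (mul_le_mul_of_nonneg_right hff zero_le_one)
        have h4 : f y * h y + f y ^ 2 + f y ^ 2 * (θ * h y) ≤ 3 * B ^ 2 := by linarith
        calc Real.exp (θ * f y) * (1 + θ * h y)
            ≤ (1 + θ * f y + (θ * f y) ^ 2) * (1 + θ * h y) :=
              mul_le_mul_of_nonneg_right hexp (by linarith [hu y])
          _ = 1 + θ * (f y + h y) +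
              θ ^ 2 * (f y * h y + f y ^ 2 + f y ^ 2 * (θ * h y)) := by ring
          _ ≤ 1 + θ * (f y + h y) + θ ^ 2 * (3 * B ^ 2) := by gcongr
          _ = _ := by ring
      calc ∑ y, Q x y * (Real.exp (θ * f y) * (1 + θ * h y))
          ≤ ∑ y, Q x y * (1 + θ * (f y + h y) + 3 * B ^ 2 * θ ^ 2) :=
            Finset.sum_le_sum fun y _ => mul_le_mul_of_nonneg_left (hy y) (hnn x y)
        _ = (∑ y, Q x y) * (1 + 3 * B ^ 2 * θ ^ 2) + θ * ∑ y, Q x y * (f y + h y) := by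
            rw [Finset.sum_mul, Finset.mul_sum, ← Finset.sum_add_distrib]
            exact Finset.sum_congr rfl fun y _ => by ring
        _ = 1 + θ * h x + 3 * B ^ 2 * θ ^ 2 := by
            rw [h1, Matrix.sum_row_of_mem_rowStochastic hs]
            ring
        _ ≤ (6 * B ^ 2 * θ ^ 2 + 1) * (1 + θ * h x) := by
            nlinarith [hu x, mul_nonneg (sq_nonneg B) (sq_nonneg θ)]
        _ ≤ _ := mul_le_mul_of_nonneg_right (Real.add_one_le_exp _) (by linarith [hu x])
    calc ∑ y, Q x y * (Real.exp (θ * f y) *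
          ((twisted Q fun y => Real.exp (θ * f y)) ^ K) (fun y => 1 + θ * h y) y)
        ≤ ∑ y, Q x y * (Real.exp (θ * f y) *
          (Real.exp (6 * B ^ 2 * θ ^ 2 * K) * (1 + θ * h y))) :=
          Finset.sum_le_sum fun y _ => mul_le_mul_of_nonneg_left
            (mul_le_mul_of_nonneg_left (ih y) (Real.exp_nonneg _)) (hnn x y)
      _ = Real.exp (6 * B ^ 2 * θ ^ 2 * K) *
          ∑ y, Q x y * (Real.exp (θ * f y) * (1 + θ * h y)) := by
          rw [Finset.mul_sum]
          exact Finset.sum_congr rfl fun y _ => by ring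
      _ ≤ Real.exp (6 * B ^ 2 * θ ^ 2 * K) *
          (Real.exp (6 * B ^ 2 * θ ^ 2) * (1 + θ * h x)) :=
          mul_le_mul_of_nonneg_left hstep (Real.exp_nonneg _)
      _ = _ := by
          rw [← mul_assoc, ← Real.exp_add]
          congr 2
          push_cast
          ring

variable [IsProbabilityMeasure P]

/-- A Chernoff bound, uniform in the position of the window. -/
lemma IsChannelChain.exists_measureReal_window_le (hC : IsChannelChain P ℱ Q C) {f h : E → ℝ}
    (h1 : ∀ x, ∑ y, Q x y * (f y + h y) = h x) {ε : ℝ} (hε : 0 < ε) :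
    ∃ c > 0, ∀ s ≥ 1, ∀ K : ℕ,
      P.real {ω | ε * K ≤ ∑ r ∈ Finset.Ioc s (s + K), f (C r ω)} ≤ 3 * Real.exp (-c * K) := by
  obtain ⟨M, hM⟩ := (Set.finite_range fun e => max |f e| |h e|).bddAbove
  set B : ℝ := max M 1 with hBdef
  have hB : ∀ e, max |f e| |h e| ≤ B := fun e => (hM ⟨e, rfl⟩).trans (le_max_left _ _)
  have hB1 : 1 ≤ B := le_max_right _ _
  have hf : ∀ e, |f e| ≤ B := fun e => (le_max_left _ _).trans (hB e)
  have hh : ∀ e, |h e| ≤ B := fun e => (le_max_right _ _).trans (hB e)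
  set θ : ℝ := min (1 / (2 * B)) (ε / (12 * B ^ 2)) with hθdef
  have hθ : 0 < θ := lt_min (by positivity) (by positivity)
  have hθB : θ * B ≤ 1 / 2 := by
    have := mul_le_mul_of_nonneg_right (min_le_left (1 / (2 * B)) (ε / (12 * B ^ 2)))
      (by linarith : 0 ≤ B)
    refine this.trans_eq ?_
    field_simp
  have hθε : 12 * B ^ 2 * θ ≤ ε := by
    have := mul_le_mul_of_nonneg_left (min_le_right (1 / (2 * B)) (ε / (12 * B ^ 2)))
      (by positivity : 0 ≤ 12 * B ^ 2)
    refine this.trans_eq ?_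
    field_simp
  refine ⟨θ * ε / 2, by positivity, fun s hs K => ?_⟩
  set S : Ω → ℝ := fun ω => ∑ r ∈ Finset.Ioc s (s + K), f (C r ω) with hS
  have hu : ∀ y, |θ * h y| ≤ 1 / 2 := by
    intro y
    rw [abs_mul, abs_of_pos hθ]
    exact (mul_le_mul_of_nonneg_left (hh y) hθ.le).trans hθB
  have hSm : Measurable S := Finset.measurable_fun_sum _ fun r hr =>
    ((hC.stronglyMeasurable_comp (by rw [Finset.mem_Ioc] at hr; omega) le_rfl f).mono
      (ℱ.le r)).measurable
  have hSb : ∀ ω, |S ω| ≤ K * B := by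
    intro ω
    refine (Finset.abs_sum_le_sum_abs _ _).trans ((Finset.sum_le_sum fun r _ => hf _).trans_eq ?_)
    simp
  have hint : Integrable (fun ω => Real.exp (θ * S ω)) P := by
    refine Integrable.of_bound (by fun_prop) (Real.exp (θ * (K * B))) (ae_of_all _ fun ω => ?_)
    rw [Real.norm_eq_abs, Real.abs_exp]
    gcongr
    exact (abs_le.1 (hSb ω)).2
  have hCm : ∀ r, 1 ≤ r → ∀ k : E → ℝ, Measurable fun ω => k (C r ω) := fun r hr k =>
    ((hC.stronglyMeasurable_comp hr le_rfl k).mono (ℱ.le r)).measurable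
  have hprod := hC.integral_prod_mul (𝕜 := ℝ) hs (F := fun _ => 1) stronglyMeasurable_const
    (B := 1) (by simp) (fun y => Real.exp (θ * f y)) K (fun y => 1 + θ * h y)
  simp only [one_mul, ← Real.exp_sum, ← Finset.mul_sum] at hprod
  have hmgf : mgf S P θ ≤ 3 * Real.exp (6 * B ^ 2 * θ ^ 2 * K) := by
    have h2 : ∫ ω, Real.exp (θ * S ω) * (1 / 2) ∂P ≤
        ∫ ω, Real.exp (θ * S ω) * (1 + θ * h (C (s + K) ω)) ∂P := by
      refine integral_mono (hint.mul_const _) ?_ fun ω => ?_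
      · refine hint.mul_bdd (c := 2) ?_ (ae_of_all _ fun ω => ?_)
        · exact (hCm (s + K) (by omega) fun y => 1 + θ * h y).aestronglyMeasurable
        · rw [Real.norm_eq_abs, abs_le]
          have := abs_le.1 (hu (C (s + K) ω))
          constructor <;> linarith [this.1, this.2]
      · refine mul_le_mul_of_nonneg_left ?_ (Real.exp_nonneg _)
        linarith [(abs_le.1 (hu (C (s + K) ω))).1]
    have h3 : ∫ ω, ((twisted Q fun y => Real.exp (θ * f y)) ^ K) (fun y => 1 + θ * h y) (C s ω) ∂P
        ≤ Real.exp (6 * B ^ 2 * θ ^ 2 * K) * (3 / 2) := by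
      have hle : ∀ ω, ((twisted Q fun y => Real.exp (θ * f y)) ^ K) (fun y => 1 + θ * h y) (C s ω)
          ≤ Real.exp (6 * B ^ 2 * θ ^ 2 * K) * (3 / 2) := fun ω =>
        (twisted_exp_pow_le hC.stochastic h1 hθ.le hθB hf hh K _).trans
          (mul_le_mul_of_nonneg_left (by linarith [(abs_le.1 (hu (C s ω))).2])
            (Real.exp_nonneg _))
      obtain ⟨D, hD⟩ := (Set.finite_range fun e =>
        ‖((twisted Q fun y => Real.exp (θ * f y)) ^ K) (fun y => 1 + θ * h y) e‖).bddAbove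
      have hi := Integrable.of_bound (μ := P) (hCm s hs
        (((twisted Q fun y => Real.exp (θ * f y)) ^ K) (fun y => 1 + θ * h y))).aestronglyMeasurable
        D (ae_of_all _ fun ω => hD ⟨_, rfl⟩)
      refine (integral_mono hi (integrable_const _) hle).trans_eq ?_
      simp
    rw [integral_mul_const] at h2
    have h4 := (h2.trans_eq hprod).trans h3
    rw [mgf]
    linarith
  have hch := measure_ge_le_exp_mul_mgf (μ := P) (X := S) (t := θ) (ε * K) hθ.le hint
  refine hch.trans ((mul_le_mul_of_nonneg_left hmgf (Real.exp_nonneg _)).trans ?_)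
  rw [mul_left_comm, ← Real.exp_add]
  refine mul_le_mul_of_nonneg_left (Real.exp_le_exp.2 ?_) (by norm_num)
  have : 6 * B ^ 2 * θ ^ 2 ≤ θ * ε / 2 := by nlinarith
  nlinarith [mul_le_mul_of_nonneg_right this (Nat.cast_nonneg (α := ℝ) K)]

/-- Almost surely, from some `n` on, all windows of length `K n` that start in `1, …, n` have sums
within `ε (K n)` of their mean: `K n` only has to grow fast enough for Borel–Cantelli. -/
lemma IsChannelChain.ae_eventually_window (hC : IsChannelChain P ℱ Q C) {g h : E → ℝ} {m : ℝ}
    (h1 : ∀ x, ∑ y, Q x y * (g y + h y) = m + h x) {K : ℕ → ℕ}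
    (hK : ∀ c > 0, Summable fun n : ℕ => (n : ℝ) * Real.exp (-c * K n)) {ε : ℝ} (hε : 0 < ε) :
    ∀ᵐ ω ∂P, ∀ᶠ n in atTop, ∀ s ∈ Finset.Icc 1 n,
      |∑ r ∈ Finset.Ioc s (s + K n), g (C r ω) - K n * m| ≤ ε * K n := by
  have hp := sum_mul_sub_add_of_poisson hC.stochastic h1
  have hn : ∀ x, ∑ y, Q x y * (-(g y - m) + -h y) = -h x := by
    intro x
    rw [← hp, ← Finset.sum_neg_distrib]
    exact Finset.sum_congr rfl fun y _ => by ring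
  obtain ⟨c₁, hc₁, hw₁⟩ := hC.exists_measureReal_window_le hp hε
  obtain ⟨c₂, hc₂, hw₂⟩ := hC.exists_measureReal_window_le (h := fun y => -h y) hn hε
  set bad : ℕ → Set Ω := fun n => ⋃ s ∈ Finset.Icc 1 n,
    ({ω | ε * K n ≤ ∑ r ∈ Finset.Ioc s (s + K n), (g (C r ω) - m)} ∪
      {ω | ε * K n ≤ ∑ r ∈ Finset.Ioc s (s + K n), -(g (C r ω) - m)}) with hbad
  have hbd : ∀ n, P (bad n) ≤ ENNReal.ofReal
      (3 * (n * Real.exp (-c₁ * K n)) + 3 * (n * Real.exp (-c₂ * K n))) := by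
    intro n
    rw [← ofReal_measureReal (measure_ne_top P (bad n))]
    refine ENNReal.ofReal_le_ofReal ?_
    calc P.real (bad n) ≤ ∑ s ∈ Finset.Icc 1 n,
          (3 * Real.exp (-c₁ * K n) + 3 * Real.exp (-c₂ * K n)) := by
          refine (measureReal_biUnion_finset_le _ _).trans (Finset.sum_le_sum fun s hs => ?_)
          have hs1 := (Finset.mem_Icc.1 hs).1
          exact (measureReal_union_le _ _).trans (add_le_add (hw₁ s hs1 _) (hw₂ s hs1 _))
      _ = _ := by
          simp only [Finset.sum_const, Nat.card_Icc, nsmul_eq_mul, Nat.add_sub_cancel]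
          ring
  have hsum : ∑' n, P (bad n) ≠ ⊤ := by
    refine ne_top_of_le_ne_top ?_ (ENNReal.tsum_le_tsum hbd)
    exact (((hK c₁ hc₁).mul_left 3).add ((hK c₂ hc₂).mul_left 3)).tsum_ofReal_ne_top
  filter_upwards [ae_eventually_notMem hsum] with ω hω
  filter_upwards [hω] with n hn s hs
  simp only [hbad, Set.mem_iUnion, not_exists] at hn
  have h2 := hn s hs
  simp only [Set.mem_union, Set.mem_ofPred_eq, not_or, not_le, Finset.sum_neg_distrib,
    Finset.sum_sub_distrib, Finset.sum_const, Nat.card_Ioc, nsmul_eq_mul,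
    Nat.add_sub_cancel_left] at h2
  rw [abs_le]
  constructor <;> linarith [h2.1, h2.2]

/-- The strong law of large numbers for a function of a finite irreducible chain. -/
theorem IsChannelChain.hasTemporalMean (hC : IsChannelChain P ℱ Q C) {g h : E → ℝ} {m : ℝ}
    (h1 : ∀ x, ∑ y, Q x y * (g y + h y) = m + h x) :
    HasTemporalMean P (fun t ω => g (C t ω)) m := by
  have hK : ∀ c > 0, Summable fun n : ℕ => (n : ℝ) * Real.exp (-c * n) := by
    intro c hc
    simpa using Real.summable_pow_mul_exp_neg_nat_mul 1 hc
  have hall : ∀ᵐ ω ∂P, ∀ j : ℕ, ∀ᶠ n in atTop, ∀ s ∈ Finset.Icc 1 n,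
      |∑ r ∈ Finset.Ioc s (s + n), g (C r ω) - n * m| ≤ 1 / ((j : ℝ) + 1) * n :=
    ae_all_iff.2 fun j => hC.ae_eventually_window h1 (K := id) hK (by positivity)
  filter_upwards [hall] with ω hω
  have h2 : Tendsto (fun n : ℕ => (∑ r ∈ Finset.Ioc 1 (1 + n), g (C r ω)) / (n : ℝ)) atTop
      (𝓝 m) := by
    refine Metric.tendsto_atTop'.2 fun ε hε => ?_
    obtain ⟨j, hj⟩ := exists_nat_one_div_lt hε
    obtain ⟨n₀, hn₀⟩ := eventually_atTop.1 (hω j)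
    refine ⟨n₀, fun n hn => ?_⟩
    have hn0 : (0 : ℝ) < n := by exact_mod_cast (by omega : 0 < n)
    have h3 := hn₀ n hn.le 1 (Finset.mem_Icc.2 ⟨le_rfl, by omega⟩)
    rw [Real.dist_eq, show (∑ r ∈ Finset.Ioc 1 (1 + n), g (C r ω)) / (n : ℝ) - m =
      (∑ r ∈ Finset.Ioc 1 (1 + n), g (C r ω) - n * m) / n by field_simp, abs_div,
      abs_of_pos hn0, div_lt_iff₀ hn0]
    exact h3.trans_lt (mul_lt_mul_of_pos_right hj hn0)
  rw [← tendsto_add_atTop_iff_nat 1]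
  have h3 := h2.mul (tendsto_natCast_div_add_atTop (1 : ℝ))
  have h4 : Tendsto (fun n : ℕ => g (C 1 ω) / ((n : ℝ) + 1)) atTop (𝓝 0) :=
    tendsto_const_nhds.div_atTop (tendsto_natCast_atTop_atTop.atTop_add tendsto_const_nhds)
  have h5 := h4.add h3
  rw [zero_add, mul_one] at h5
  refine h5.congr' ?_
  filter_upwards [eventually_gt_atTop 0] with n hn
  have hn0 : (n : ℝ) ≠ 0 := by exact_mod_cast hn.ne'
  rw [← Finset.add_sum_Ioc_eq_sum_Icc (by omega : 1 ≤ n + 1), add_comm n 1]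
  push_cast
  field_simp
  ring

end Concentration

/-! ### Drift of the deficits along a sample path -/

section LayerCake

lemma intervalIntegrable_ite_lt (r a b : ℝ) :
    IntervalIntegrable (fun s : ℝ => if s < r then (1 : ℝ) else 0) volume a b := by
  refine Antitone.intervalIntegrable fun s t hst => ?_
  split_ifs with h1 h2 <;> first | exact le_rfl | exact zero_le_one | skip
  exact absurd (hst.trans_lt h1) h2

lemma integral_ite_lt {r a b : ℝ} (har : a ≤ r) (hrb : r ≤ b) :
    ∫ s in a..b, (if s < r then (1 : ℝ) else 0) = r - a := by
  rw [← intervalIntegral.integral_add_adjacent_intervals (intervalIntegrable_ite_lt r a r)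
    (intervalIntegrable_ite_lt r r b)]
  have h1 : ∫ s in a..r, (if s < r then (1 : ℝ) else 0) = ∫ s in a..r, (1 : ℝ) := by
    refine intervalIntegral.integral_congr_Ioo_of_le har fun s hs => ?_
    simp [hs.2]
  have h2 : ∫ s in r..b, (if s < r then (1 : ℝ) else 0) = ∫ s in r..b, (0 : ℝ) := by
    refine intervalIntegral.integral_congr fun s hs => ?_
    rw [Set.uIcc_of_le hrb] at hs
    simp [hs.1]
  rw [h1, h2]
  simp

variable {Ω E : Type*} {N : ℕ} {on : Fin N → Set E} {C : ℕ → Ω → E} {ω : Ω}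

/-- The max-weight inequality. Suppose that, over the slots `J`, every nonempty proper set of clients
has a channel ON at least `η` more often than its demand `K ∑ μ`, and that the demand of all clients
is met up to `κ`. Then giving each slot to the available client of largest weight `x` beats the
demands by `η` times the spread `b - a` of the weights, up to `κ |a|`. Both sides are compared level
set by level set: a slot in which the best available weight exceeds `s` is one in which the set
`{x > s}` has a channel ON. -/
lemma sum_mul_sub_sum_top_le {μ x : Fin N → ℝ} {a b η κ K : ℝ} {J : Finset ℕ}
    {top : ℕ → Option (Fin N)}
    (htop : ∀ t ∈ J, ∀ j, top t = some j → C t ω ∈ on j ∧ ∀ i, C t ω ∈ on i → x i ≤ x j)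
    (hnone : ∀ t ∈ J, top t = none → ∀ i, C t ω ∉ on i)
    (ha : ∀ i, a ≤ x i) (ha' : ∃ i, x i = a) (hb : ∀ i, x i ≤ b) (hb' : ∃ i, x i = b)
    (hS : ∀ S : Finset (Fin N), S.Nonempty → S ≠ Finset.univ →
      K * ∑ i ∈ S, μ i - ∑ t ∈ J, channelOn on C S t ω ≤ -η)
    (hU : |K * ∑ i, μ i - ∑ t ∈ J, channelOn on C Finset.univ t ω| ≤ κ) :
    K * ∑ i, x i * μ i - ∑ t ∈ J, (top t).elim 0 x ≤ -η * (b - a) + κ * |a| := by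
  classical
  have hab : a ≤ b := by
    obtain ⟨i, hi⟩ := ha'
    exact hi ▸ hb i
  set q : ℕ → ℝ → ℝ := fun t s => (top t).elim 0 fun j => if s < x j then 1 else 0 with hq
  have hqi : ∀ t, IntervalIntegrable (q t) volume a b := by
    intro t
    simp only [hq]
    cases top t with
    | none => simp
    | some j => exact intervalIntegrable_ite_lt _ _ _
  have hqint : ∀ t ∈ J, ∫ s in a..b, q t s =
      (top t).elim 0 x - a * channelOn on C Finset.univ t ω := by
    intro t ht
    simp only [hq]
    cases h : top t with
    | none =>
      have : channelOn on C Finset.univ t ω = 0 := by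
        rw [channelOn, if_neg]
        rintro ⟨i, -, hi⟩
        exact hnone t ht h i hi
      simp [this]
    | some j =>
      have : channelOn on C Finset.univ t ω = 1 := by
        rw [channelOn, if_pos]
        exact ⟨j, Finset.mem_univ _, (htop t ht j h).1⟩
      simp only [Option.elim_some]
      rw [integral_ite_lt (ha j) (hb j), this, mul_one]
  have hμi : IntervalIntegrable (fun s => ∑ i, μ i * if s < x i then (1 : ℝ) else 0) volume a b := by
    have := IntervalIntegrable.sum Finset.univ fun i _ =>
      (intervalIntegrable_ite_lt (x i) a b).const_mul (μ i)
    rwa [Finset.sum_fn] at this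
  have hqs : IntervalIntegrable (fun s => ∑ t ∈ J, q t s) volume a b := by
    have := IntervalIntegrable.sum J fun t _ => hqi t
    rwa [Finset.sum_fn] at this
  have hint : ∫ s in a..b, (K * ∑ i, μ i * (if s < x i then 1 else 0) - ∑ t ∈ J, q t s) =
      K * ∑ i, μ i * (x i - a) -
        ∑ t ∈ J, ((top t).elim 0 x - a * channelOn on C Finset.univ t ω) := by
    rw [intervalIntegral.integral_sub, intervalIntegral.integral_const_mul,
      intervalIntegral.integral_finsetSum, intervalIntegral.integral_finsetSum]
    · rw [Finset.sum_congr rfl hqint]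
      simp only [intervalIntegral.integral_const_mul, integral_ite_lt (ha _) (hb _)]
    · exact fun t _ => hqi t
    · exact fun i _ => (intervalIntegrable_ite_lt _ _ _).const_mul _
    · exact hμi.const_mul _
    · exact hqs
  have hle : ∫ s in a..b, (K * ∑ i, μ i * (if s < x i then 1 else 0) - ∑ t ∈ J, q t s) ≤
      ∫ s in a..b, -η := by
    refine intervalIntegral.integral_mono_on_of_le_Ioo hab 
      ((hμi.const_mul _).sub hqs) (by simp) fun s hs => ?_
    · have h1 : ∑ i, μ i * (if s < x i then (1 : ℝ) else 0) =
          ∑ i ∈ Finset.univ.filter fun i => s < x i, μ i := by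
        simp [Finset.sum_filter]
      have h2 : ∀ t ∈ J, q t s = channelOn on C (Finset.univ.filter fun i => s < x i) t ω := by
        intro t ht
        simp only [hq, channelOn, Finset.mem_filter, Finset.mem_univ, true_and]
        cases h : top t with
        | none =>
          rw [if_neg]
          · rfl
          · rintro ⟨i, -, hi⟩
            exact hnone t ht h i hi
        | some j =>
          simp only [Option.elim_some]
          congr 1
          refine propext ⟨fun hj => ⟨j, hj, (htop t ht j h).1⟩, ?_⟩
          rintro ⟨i, hi, hi'⟩
          exact hi.trans_le ((htop t ht j h).2 i hi')
      rw [h1, Finset.sum_congr rfl h2]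
      refine hS _ ?_ ?_
      · obtain ⟨i, hi⟩ := hb'
        exact ⟨i, by simp [hi, hs.2]⟩
      · obtain ⟨i, hi⟩ := ha'
        intro h
        have := (Finset.mem_filter.1 (h ▸ Finset.mem_univ i)).2
        exact absurd this (by rw [hi]; exact not_lt.2 hs.1.le)
  rw [hint, intervalIntegral.integral_const, smul_eq_mul] at hle
  have e : K * ∑ i, μ i * (x i - a) -
      ∑ t ∈ J, ((top t).elim 0 x - a * channelOn on C Finset.univ t ω) =
      (K * ∑ i, x i * μ i - ∑ t ∈ J, (top t).elim 0 x) -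
        a * (K * ∑ i, μ i - ∑ t ∈ J, channelOn on C Finset.univ t ω) := by
    have e' : ∑ i, μ i * (x i - a) = ∑ i, x i * μ i - a * ∑ i, μ i := by
      rw [Finset.mul_sum, ← Finset.sum_sub_distrib]
      exact Finset.sum_congr rfl fun i _ => by ring
    rw [e', Finset.sum_sub_distrib, ← Finset.mul_sum]
    ring
  rw [e] at hle
  have h3 : a * (K * ∑ i, μ i - ∑ t ∈ J, channelOn on C Finset.univ t ω) ≤ κ * |a| := by
    refine (le_abs_self _).trans ?_
    rw [abs_mul, mul_comm]
    exact mul_le_mul_of_nonneg_right hU (abs_nonneg _)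
  linarith

end LayerCake

section Drift

variable {Ω E : Type*} {N : ℕ} {on : Fin N → Set E} {C : ℕ → Ω → E} {ω : Ω}
  {μ σsq : Fin N → ℝ} {A : ℕ → Ω → Option (Fin N)}

/-- The signed distance of the weighted deficit `d_i(t) / √σsq_i` of client `i` from the common
value `∑ d_j(t) / ∑ √σsq_j` that all the weighted deficits would have if they were equal. -/
noncomputable def imbalance (μ σsq : Fin N → ℝ) (A : ℕ → Ω → Option (Fin N)) (i : Fin N) (t : ℕ)
    (ω : Ω) : ℝ :=
  deficit μ A i t ω / √(σsq i) - (∑ j, deficit μ A j t ω) / ∑ j, √(σsq j)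

lemma deficit_add_sub (i : Fin N) (s k : ℕ) :
    deficit μ A i (s + k) ω - deficit μ A i s ω =
      k * μ i - ∑ t ∈ Finset.Ioc s (s + k), delivery A i t ω := by
  have h : ∀ n : ℕ, ∑ t ∈ Finset.Icc 1 n, delivery A i t ω =
      ∑ t ∈ Finset.Ioc 0 n, delivery A i t ω := fun n => by
    rw [← Finset.Icc_add_one_left_eq_Ioc, zero_add]
  simp only [deficit, h]
  rw [← Finset.sum_Ioc_consecutive _ (Nat.zero_le s) (Nat.le_add_right s k)]
  push_cast
  ring

lemma sum_mul_delivery (x : Fin N → ℝ) (t : ℕ) :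
    ∑ i, x i * delivery A i t ω = (A t ω).elim 0 x := by
  cases h : A t ω with
  | none => simp [delivery, h]
  | some j => simp [delivery, h]

lemma abs_deficit_add_sub_le (hμ : ∀ i, 0 ≤ μ i) (i : Fin N) (s k : ℕ) :
    |deficit μ A i (s + k) ω - deficit μ A i s ω| ≤ k * (1 + ∑ j, μ j) := by
  have h0 : 0 ≤ ∑ t ∈ Finset.Ioc s (s + k), delivery A i t ω :=
    Finset.sum_nonneg fun t _ => by unfold delivery; split_ifs <;> norm_num
  have h1 : ∑ t ∈ Finset.Ioc s (s + k), delivery A i t ω ≤ k := by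
    calc ∑ t ∈ Finset.Ioc s (s + k), delivery A i t ω
        ≤ ∑ t ∈ Finset.Ioc s (s + k), (1 : ℝ) :=
          Finset.sum_le_sum fun t _ => by unfold delivery; split_ifs <;> norm_num
      _ = k := by simp
  have h2 : μ i ≤ ∑ j, μ j := Finset.single_le_sum (fun j _ => hμ j) (Finset.mem_univ i)
  have hk : (0 : ℝ) ≤ k := Nat.cast_nonneg k
  have h3 := mul_le_mul_of_nonneg_left h2 hk
  have h4 := mul_nonneg hk (hμ i)
  rw [deficit_add_sub, abs_le]
  constructor <;> linarith

variable {L : ℝ} (hσ : ∀ i, 0 < σsq i) (hμ : ∀ i, 0 ≤ μ i)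
  (hL : ∀ i, 1 + ∑ j, μ j ≤ L * √(σsq i))

include hσ hμ hL in
lemma abs_weighted_deficit_add_sub_le (i : Fin N) (s k : ℕ) :
    |deficit μ A i (s + k) ω / √(σsq i) - deficit μ A i s ω / √(σsq i)| ≤ L * k := by
  have hw : 0 < √(σsq i) := Real.sqrt_pos.2 (hσ i)
  rw [← sub_div, abs_div, abs_of_pos hw, div_le_iff₀ hw]
  refine (abs_deficit_add_sub_le hμ i s k).trans ?_
  have := mul_le_mul_of_nonneg_left (hL i) (Nat.cast_nonneg (α := ℝ) k)
  linarith

include hσ hμ hL in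
lemma abs_imbalance_add_sub_le (i : Fin N) (s k : ℕ) :
    |imbalance μ σsq A i (s + k) ω - imbalance μ σsq A i s ω| ≤ 2 * L * k := by
  have hW : 0 < ∑ j, √(σsq j) :=
    Finset.sum_pos (fun j _ => Real.sqrt_pos.2 (hσ j)) ⟨i, Finset.mem_univ i⟩
  have h1 := abs_weighted_deficit_add_sub_le (A := A) (ω := ω) hσ hμ hL i s k
  have h2 : |(∑ j, deficit μ A j (s + k) ω) / ∑ j, √(σsq j) -
      (∑ j, deficit μ A j s ω) / ∑ j, √(σsq j)| ≤ L * k := by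
    rw [← sub_div, abs_div, abs_of_pos hW, div_le_iff₀ hW, ← Finset.sum_sub_distrib,
      Finset.mul_sum]
    refine (Finset.abs_sum_le_sum_abs _ _).trans (Finset.sum_le_sum fun j _ => ?_)
    refine (abs_deficit_add_sub_le hμ j s k).trans ?_
    have := mul_le_mul_of_nonneg_left (hL j) (Nat.cast_nonneg (α := ℝ) k)
    linarith
  rw [abs_le] at *
  unfold imbalance
  constructor <;> linarith [h1.1, h1.2, h2.1, h2.2]

include hσ in
lemma sum_sqrt_mul_imbalance (t : ℕ) : ∑ i, √(σsq i) * imbalance μ σsq A i t ω = 0 := by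
  rcases isEmpty_or_nonempty (Fin N) with h | h
  · simp
  have hW : 0 < ∑ j, √(σsq j) :=
    Finset.sum_pos (fun j _ => Real.sqrt_pos.2 (hσ j)) Finset.univ_nonempty
  have e : ∀ i, √(σsq i) * imbalance μ σsq A i t ω =
      deficit μ A i t ω - √(σsq i) * ((∑ j, deficit μ A j t ω) / ∑ j, √(σsq j)) := by
    intro i
    have hw : √(σsq i) ≠ 0 := (Real.sqrt_pos.2 (hσ i)).ne'
    unfold imbalance
    field_simp
  simp only [e, Finset.sum_sub_distrib, ← Finset.sum_mul]
  field_simp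
  ring

/-- The quadratic Lyapunov function: the weighted variance of the weighted deficits. -/
noncomputable def lyapunov (μ σsq : Fin N → ℝ) (A : ℕ → Ω → Option (Fin N)) (t : ℕ) (ω : Ω) : ℝ :=
  ∑ i, √(σsq i) * imbalance μ σsq A i t ω ^ 2

include hσ hμ hL in
/-- The identity behind the drift: the common value of the weighted deficits drops out since the
imbalances average to zero. -/
lemma lyapunov_add_le (s K : ℕ) :
    lyapunov μ σsq A (s + K) ω ≤ lyapunov μ σsq A s ω +
      2 * (K * ∑ i, imbalance μ σsq A i s ω * μ i -
        ∑ t ∈ Finset.Ioc s (s + K), (A t ω).elim 0 fun j => imbalance μ σsq A j s ω) +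
      4 * L ^ 2 * (∑ i, √(σsq i)) * K ^ 2 := by
  set x : Fin N → ℝ := fun i => imbalance μ σsq A i s ω with hx
  set Δ : Fin N → ℝ := fun i => imbalance μ σsq A i (s + K) ω - imbalance μ σsq A i s ω with hΔ
  set m : ℝ := (∑ j, deficit μ A j (s + K) ω) / ∑ j, √(σsq j) -
    (∑ j, deficit μ A j s ω) / ∑ j, √(σsq j) with hm
  have h1 : ∑ i, √(σsq i) * x i = 0 := sum_sqrt_mul_imbalance hσ s
  have h2 : ∀ i, √(σsq i) * Δ i = (deficit μ A i (s + K) ω - deficit μ A i s ω) -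
      √(σsq i) * m := by
    intro i
    have hw : √(σsq i) ≠ 0 := (Real.sqrt_pos.2 (hσ i)).ne'
    have e : Δ i = (deficit μ A i (s + K) ω - deficit μ A i s ω) / √(σsq i) - m := by
      simp only [hΔ, hm, imbalance]
      ring
    rw [e]
    field_simp
  have h3 : ∑ i, x i * (√(σsq i) * Δ i) = K * ∑ i, x i * μ i -
      ∑ t ∈ Finset.Ioc s (s + K), (A t ω).elim 0 x := by
    have e : ∀ i, x i * (√(σsq i) * Δ i) = K * (x i * μ i) -
        ∑ t ∈ Finset.Ioc s (s + K), x i * delivery A i t ω - m * (√(σsq i) * x i) := by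
      intro i
      rw [h2, deficit_add_sub, ← Finset.mul_sum]
      ring
    simp only [e, Finset.sum_sub_distrib, ← Finset.mul_sum, h1]
    rw [Finset.sum_congr rfl fun i _ => Finset.mul_sum _ _ _, Finset.sum_comm]
    simp only [sum_mul_delivery]
    ring
  have h4 : ∑ i, √(σsq i) * Δ i ^ 2 ≤ 4 * L ^ 2 * (∑ i, √(σsq i)) * K ^ 2 := by
    have e : 4 * L ^ 2 * (∑ i, √(σsq i)) * K ^ 2 = ∑ i, √(σsq i) * (2 * L * K) ^ 2 := by
      rw [← Finset.sum_mul]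
      ring
    rw [e]
    refine Finset.sum_le_sum fun i _ => mul_le_mul_of_nonneg_left ?_ (Real.sqrt_nonneg _)
    have := abs_le.1 (abs_imbalance_add_sub_le (A := A) (ω := ω) hσ hμ hL i s K)
    exact sq_le_sq' this.1 this.2
  have h5 : lyapunov μ σsq A (s + K) ω = lyapunov μ σsq A s ω +
      2 * ∑ i, x i * (√(σsq i) * Δ i) + ∑ i, √(σsq i) * Δ i ^ 2 := by
    simp only [lyapunov, Finset.mul_sum, ← Finset.sum_add_distrib]
    exact Finset.sum_congr rfl fun i _ => by simp only [hx, hΔ]; ring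
  rw [h5, h3]
  linarith

variable [mΩ : MeasurableSpace Ω] {ℱ : Filtration ℕ mΩ} (hA : IsVWD ℱ on C μ σsq A)

include hσ hμ hL hA in
/-- Within `K` slots after slot `s` the policy serves clients whose imbalance at time `s` is within
`2 L K` of the best one available. -/
lemma exists_top_le_served (hL0 : 0 ≤ L) (s K : ℕ) : ∃ top : ℕ → Option (Fin N),
    (∀ t j, top t = some j → C t ω ∈ on j ∧
      ∀ i, C t ω ∈ on i → imbalance μ σsq A i s ω ≤ imbalance μ σsq A j s ω) ∧
    (∀ t, top t = none → ∀ i, C t ω ∉ on i) ∧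
    ∀ t ∈ Finset.Ioc s (s + K), (top t).elim 0 (fun j => imbalance μ σsq A j s ω) - 2 * L * K ≤
      (A t ω).elim 0 fun j => imbalance μ σsq A j s ω := by
  have hex : ∀ t, ∃ o : Option (Fin N), (∀ j, o = some j → C t ω ∈ on j ∧
      ∀ i, C t ω ∈ on i → imbalance μ σsq A i s ω ≤ imbalance μ σsq A j s ω) ∧
      (o = none → ∀ i, C t ω ∉ on i) := by
    intro t
    rcases Set.eq_empty_or_nonempty {i | C t ω ∈ on i} with h | h
    · exact ⟨none, by simp, fun _ i hi => (h ▸ hi : i ∈ (∅ : Set (Fin N)))⟩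
    · obtain ⟨j, hj, hj'⟩ := Set.exists_max_image _ (fun i => imbalance μ σsq A i s ω)
        (Set.toFinite _) h
      refine ⟨some j, fun i hi => ?_, by simp⟩
      obtain rfl := Option.some_injective _ hi
      exact ⟨hj, hj'⟩
  choose top h1 h2 using hex
  refine ⟨top, h1, h2, fun t ht => ?_⟩
  rw [Finset.mem_Ioc] at ht
  obtain ⟨k, rfl⟩ : ∃ k, t = s + k + 1 := ⟨t - s - 1, by omega⟩
  have hkK : (k : ℝ) ≤ K := by exact_mod_cast (by omega : k ≤ K)
  cases htop : top (s + k + 1) with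
  | none =>
    have hnone : A (s + k + 1) ω = none := by
      refine Option.eq_none_iff_forall_ne_some.2 fun i hi => ?_
      exact h2 _ htop i (hA.isOn _ _ _ hi)
    rw [hnone]
    have h3 : 0 ≤ L * K := mul_nonneg hL0 (Nat.cast_nonneg K)
    simp only [Option.elim_none]
    linarith
  | some j =>
    have hj := (h1 _ j htop).1
    obtain ⟨i, hi⟩ := hA.serves (s + k) ω ⟨j, hj⟩
    have h3 := hA.largest (s + k) ω i hi j hj
    rw [hi]
    have h4 := abs_weighted_deficit_add_sub_le (A := A) (ω := ω) hσ hμ hL i s k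
    have h5 := abs_weighted_deficit_add_sub_le (A := A) (ω := ω) hσ hμ hL j s k
    have h6 := mul_le_mul_of_nonneg_left hkK hL0
    rw [abs_le] at h4 h5
    simp only [Option.elim_some, imbalance]
    linarith [h4.1, h4.2, h5.1, h5.2]

include hσ hμ hL hA in
/-- Over a window in which every set of clients sees its channels ON about as often as expected, the
Lyapunov function stays below a fixed multiple of the squared window length: either the imbalances
are of the order of the window length, or their spread, times the slack `ε`, outweighs the error
terms. -/
lemma lyapunov_add_le_of_window (hL0 : 0 ≤ L) {ε : ℝ} (hε : 0 < ε) {m : Finset (Fin N) → ℝ}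
    (hslack : ∀ S : Finset (Fin N), S.Nonempty → S ≠ Finset.univ → ∑ i ∈ S, μ i + 3 * ε ≤ m S)
    (htotal : ∑ i, μ i = m Finset.univ) {G M : ℝ} (hG : 2 * L + 2 * L ^ 2 * (∑ i, √(σsq i)) ≤ ε * G)
    (hM : (∑ i, √(σsq i)) * (G ^ 2 + 4 * L ^ 2) + 4 * L ≤ M) {s K : ℕ}
    (hwin : ∀ S : Finset (Fin N),
      |∑ t ∈ Finset.Ioc s (s + K), channelOn on C S t ω - K * m S| ≤ ε * K)
    (hV : lyapunov μ σsq A s ω ≤ M * K ^ 2) : lyapunov μ σsq A (s + K) ω ≤ M * K ^ 2 := by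
  rcases isEmpty_or_nonempty (Fin N) with hN | hN
  · have h0 : ∀ t, lyapunov μ σsq A t ω = 0 := fun t => by simp [lyapunov]
    rwa [h0] at hV ⊢
  set x : Fin N → ℝ := fun i => imbalance μ σsq A i s ω with hx
  set W : ℝ := ∑ i, √(σsq i) with hW
  have hK : (0 : ℝ) ≤ K := Nat.cast_nonneg K
  have hW0 : 0 < W :=
    Finset.sum_pos (fun j _ => Real.sqrt_pos.2 (hσ j)) Finset.univ_nonempty
  have hG0 : 0 ≤ G := by
    by_contra h
    nlinarith [mul_nonneg (sq_nonneg L) hW0.le]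
  obtain ⟨imax, hmax⟩ := Finite.exists_max x
  obtain ⟨imin, hmin⟩ := Finite.exists_min x
  have hxsum : ∑ i, √(σsq i) * x i = 0 := sum_sqrt_mul_imbalance hσ s
  have hmax0 : 0 ≤ x imax := by
    by_contra h
    refine absurd hxsum (ne_of_lt (Finset.sum_neg (fun i _ => ?_) Finset.univ_nonempty))
    exact mul_neg_of_pos_of_neg (Real.sqrt_pos.2 (hσ i)) ((hmax i).trans_lt (not_le.1 h))
  have hmin0 : x imin ≤ 0 := by
    by_contra h
    refine absurd hxsum (ne_of_gt (Finset.sum_pos (fun i _ => ?_) Finset.univ_nonempty))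
    exact mul_pos (Real.sqrt_pos.2 (hσ i)) ((not_le.1 h).trans_le (hmin i))
  obtain ⟨top, ht1, ht2, ht3⟩ := exists_top_le_served (ω := ω) hσ hμ hL hA hL0 s K
  have hserved : ∑ t ∈ Finset.Ioc s (s + K), (top t).elim 0 x - 2 * L * K ^ 2 ≤
      ∑ t ∈ Finset.Ioc s (s + K), (A t ω).elim 0 x := by
    have := Finset.sum_le_sum ht3
    rw [Finset.sum_sub_distrib] at this
    simp only [Finset.sum_const, Nat.card_Ioc, Nat.add_sub_cancel_left, nsmul_eq_mul] at this
    linarith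
  have hmw := sum_mul_sub_sum_top_le (C := C) (ω := ω) (μ := μ) (x := x) (a := x imin)
    (b := x imax) (η := 2 * ε * K) (κ := ε * K) (K := K) (J := Finset.Ioc s (s + K)) (top := top)
    (fun t _ => ht1 t) (fun t _ => ht2 t) hmin ⟨imin, rfl⟩ hmax ⟨imax, rfl⟩
    (fun S hS hS' => by
      have h1 := (abs_le.1 (hwin S)).1
      have h2 := mul_le_mul_of_nonneg_left (hslack S hS hS') hK
      linarith)
    (by rw [htotal, abs_sub_comm]; exact hwin Finset.univ)
  have hdrift : lyapunov μ σsq A (s + K) ω ≤ lyapunov μ σsq A s ω -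
      2 * ε * K * (x imax - x imin) + (4 * L + 4 * L ^ 2 * W) * K ^ 2 := by
    have h1 := lyapunov_add_le (A := A) (ω := ω) hσ hμ hL s K
    have h2 : |x imin| ≤ x imax - x imin := by
      rw [abs_of_nonpos hmin0]
      linarith
    have h3 := mul_le_mul_of_nonneg_left h2 (mul_nonneg hε.le hK)
    linarith
  rcases le_or_gt (G * K) (x imax - x imin) with h | h
  · have h1 := mul_le_mul_of_nonneg_left h (mul_nonneg hε.le hK)
    have h2 := mul_le_mul_of_nonneg_right hG (sq_nonneg (K : ℝ))
    linarith
  · have hVs : lyapunov μ σsq A s ω ≤ W * (G * K) ^ 2 := by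
      simp only [lyapunov, hW, Finset.sum_mul]
      refine Finset.sum_le_sum fun i _ => mul_le_mul_of_nonneg_left ?_ (Real.sqrt_nonneg _)
      have h3 := hmax i
      have h4 := hmin i
      exact sq_le_sq' (by linarith) (by linarith)
    have h1 : 0 ≤ 2 * ε * K * (x imax - x imin) :=
      mul_nonneg (by positivity) (by linarith)
    have h2 := mul_le_mul_of_nonneg_right hM (sq_nonneg (K : ℝ))
    linarith

include hσ hμ hL hA in
/-- If all windows of length `K` that start in `1, …, n` are good, then at time `n` the imbalances
are of order `K`. The windows are laid end to end so that the last one finishes in slot `n`. -/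
lemma lyapunov_le_of_windows (hL0 : 0 ≤ L) {ε : ℝ} (hε : 0 < ε) {m : Finset (Fin N) → ℝ}
    (hslack : ∀ S : Finset (Fin N), S.Nonempty → S ≠ Finset.univ → ∑ i ∈ S, μ i + 3 * ε ≤ m S)
    (htotal : ∑ i, μ i = m Finset.univ) {G M : ℝ} (hG : 2 * L + 2 * L ^ 2 * (∑ i, √(σsq i)) ≤ ε * G)
    (hM : (∑ i, √(σsq i)) * (G ^ 2 + 4 * L ^ 2) + 4 * L ≤ M) {n K : ℕ} (hn : 1 ≤ n) (hK : 1 ≤ K)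
    (hwin : ∀ S : Finset (Fin N), ∀ s ∈ Finset.Icc 1 n,
      |∑ t ∈ Finset.Ioc s (s + K), channelOn on C S t ω - K * m S| ≤ ε * K) :
    lyapunov μ σsq A n ω ≤ M * K ^ 2 := by
  have hstart : ∀ s ≤ K, lyapunov μ σsq A s ω ≤ M * K ^ 2 := by
    intro s hs
    have h0 : ∀ i, imbalance μ σsq A i 0 ω = 0 := fun i => by simp [imbalance, deficit]
    have h1 : lyapunov μ σsq A s ω ≤ ∑ i, √(σsq i) * (2 * L * K) ^ 2 := by
      refine Finset.sum_le_sum fun i _ => mul_le_mul_of_nonneg_left ?_ (Real.sqrt_nonneg _)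
      have h2 := abs_imbalance_add_sub_le (A := A) (ω := ω) hσ hμ hL i 0 s
      rw [zero_add, h0, sub_zero] at h2
      have h3 : (s : ℝ) ≤ K := by exact_mod_cast hs
      have h4 := abs_le.1 (h2.trans (mul_le_mul_of_nonneg_left h3 (by positivity)))
      exact sq_le_sq' h4.1 h4.2
    rw [← Finset.sum_mul] at h1
    have h2 := mul_le_mul_of_nonneg_right hM (sq_nonneg (K : ℝ))
    have h3 : 0 ≤ (∑ i, √(σsq i)) * G ^ 2 * (K : ℝ) ^ 2 := mul_nonneg (mul_nonneg
      (Finset.sum_nonneg fun i _ => Real.sqrt_nonneg _) (sq_nonneg _)) (sq_nonneg _)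
    have h4 : 0 ≤ L * (K : ℝ) ^ 2 := by positivity
    linarith
  have hind : ∀ j : ℕ, 1 + (n - 1) % K + j * K ≤ n →
      lyapunov μ σsq A (1 + (n - 1) % K + j * K) ω ≤ M * K ^ 2 := by
    intro j
    induction j with
    | zero =>
      intro _
      have := Nat.mod_lt (n - 1) hK
      exact hstart _ (by omega)
    | succ j ih =>
      intro hj
      rw [Nat.succ_mul, ← add_assoc] at hj ⊢
      refine lyapunov_add_le_of_window hσ hμ hL hA hL0 hε hslack htotal hG hM (fun S => ?_)
        (ih (by omega))
      exact hwin S _ (Finset.mem_Icc.2 ⟨by omega, by omega⟩)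
  have h1 : 1 + (n - 1) % K + (n - 1) / K * K = n := by
    have := Nat.mod_add_div' (n - 1) K
    omega
  have := hind ((n - 1) / K) h1.le
  rwa [h1] at this

include hσ hA in
/-- The deliveries to one client are, up to its imbalance, a fixed share of the total. -/
lemma sum_delivery_sub_eq (i : Fin N) (T : ℕ) :
    ∑ t ∈ Finset.Icc 1 T, delivery A i t ω - T * μ i =
      √(σsq i) / (∑ j, √(σsq j)) *
        (∑ t ∈ Finset.Icc 1 T, channelOn on C Finset.univ t ω - T * ∑ j, μ j) -
      √(σsq i) * imbalance μ σsq A i T ω := by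
  have hw : √(σsq i) ≠ 0 := (Real.sqrt_pos.2 (hσ i)).ne'
  have h1 : ∀ t ∈ Finset.Icc 1 T, ∑ j, delivery A j t ω = channelOn on C Finset.univ t ω := by
    intro t ht
    obtain ⟨k, rfl⟩ : ∃ k, t = k + 1 := ⟨t - 1, by have := (Finset.mem_Icc.1 ht).1; omega⟩
    have h2 := sum_mul_delivery (A := A) (ω := ω) (fun _ => 1) (k + 1)
    simp only [one_mul] at h2
    rw [h2, channelOn]
    cases h3 : A (k + 1) ω with
    | none =>
      rw [if_neg]
      · rfl
      · rintro ⟨j, -, hj⟩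
        obtain ⟨l, hl⟩ := hA.serves k ω ⟨j, hj⟩
        rw [h3] at hl
        exact absurd hl (by simp)
    | some j => rw [if_pos ⟨j, Finset.mem_univ _, hA.isOn k ω j h3⟩]; rfl
  have h2 : ∑ j, deficit μ A j T ω =
      T * ∑ j, μ j - ∑ t ∈ Finset.Icc 1 T, channelOn on C Finset.univ t ω := by
    simp only [deficit, Finset.sum_sub_distrib, ← Finset.mul_sum]
    rw [Finset.sum_comm, Finset.sum_congr rfl h1]
  have h3 : √(σsq i) * (deficit μ A i T ω / √(σsq i)) = deficit μ A i T ω := by field_simp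
  rw [imbalance, h2, mul_sub (√(σsq i)), h3, deficit]
  ring

end Drift

/-! ### Collapse of the deficits onto a line -/

/-- The window lengths `⌈n ^ (1/4)⌉`: long enough for the window estimates to be summable, and short
compared with `√n`. -/
noncomputable def windowLength (n : ℕ) : ℕ := ⌈√√(n : ℝ)⌉₊

lemma one_le_windowLength {n : ℕ} (hn : 1 ≤ n) : 1 ≤ windowLength n := by
  have : (0 : ℝ) < n := by exact_mod_cast hn
  exact Nat.one_le_ceil_iff.2 (by positivity)

lemma tendsto_windowLength_div_sqrt :
    Tendsto (fun n : ℕ => (windowLength n : ℝ) / √(n : ℝ)) atTop (𝓝 0) := by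
  have h1 : Tendsto (fun n : ℕ => √(n : ℝ)) atTop atTop :=
    Real.tendsto_sqrt_atTop.comp tendsto_natCast_atTop_atTop
  have h2 : Tendsto (fun n : ℕ => √√(n : ℝ)) atTop atTop := Real.tendsto_sqrt_atTop.comp h1
  have h3 := h2.inv_tendsto_atTop.add h1.inv_tendsto_atTop
  rw [add_zero] at h3
  refine squeeze_zero' (Eventually.of_forall fun n => by positivity) ?_ h3
  filter_upwards [eventually_gt_atTop 0] with n hn
  have hn0 : (0 : ℝ) < n := by exact_mod_cast hn
  have h4 : (windowLength n : ℝ) ≤ √√(n : ℝ) + 1 := (Nat.ceil_lt_add_one (by positivity)).le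
  have h5 : (0 : ℝ) < √√(n : ℝ) := by positivity
  have h6 : √(n : ℝ) = √√(n : ℝ) * √√(n : ℝ) := (Real.mul_self_sqrt (by positivity)).symm
  calc (windowLength n : ℝ) / √(n : ℝ) ≤ (√√(n : ℝ) + 1) / √(n : ℝ) := by gcongr
    _ = √√(n : ℝ) / (√√(n : ℝ) * √√(n : ℝ)) + 1 / √(n : ℝ) := by rw [← h6, add_div]
    _ = _ := by
      simp only [Pi.inv_apply]
      field_simp

lemma summable_mul_exp_neg_windowLength {c : ℝ} (hc : 0 < c) :
    Summable fun n : ℕ => (n : ℝ) * Real.exp (-c * windowLength n) := by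
  have hs : Summable fun n : ℕ => (Nat.factorial 12 / c ^ 12) * ((n : ℝ) ^ 2)⁻¹ :=
    (Real.summable_nat_pow_inv.2 (by norm_num)).mul_left _
  refine Summable.of_nonneg_of_le (fun n => by positivity) (fun n => ?_) hs
  rcases Nat.eq_zero_or_pos n with rfl | hn
  · simp
  have hn0 : (0 : ℝ) < n := by exact_mod_cast hn
  set K : ℝ := (windowLength n : ℝ) with hK
  have hK1 : √√(n : ℝ) ≤ K := Nat.le_ceil _
  have hK4 : (n : ℝ) ≤ K ^ 4 := by
    calc (n : ℝ) = √√(n : ℝ) ^ 4 := by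
          rw [show 4 = 2 * 2 by norm_num, pow_mul, Real.sq_sqrt (by positivity),
            Real.sq_sqrt (by positivity)]
      _ ≤ K ^ 4 := by gcongr
  have hK0 : 0 < K := (by positivity : (0 : ℝ) < √√(n : ℝ)).trans_le hK1
  have hexp := Real.pow_div_factorial_le_exp (c * K) (by positivity) 12
  have hn3 : (n : ℝ) ^ 3 ≤ K ^ 12 := by
    calc (n : ℝ) ^ 3 ≤ (K ^ 4) ^ 3 := by gcongr
      _ = K ^ 12 := by ring
  have h1 : c ^ 12 * (n : ℝ) ^ 3 / Nat.factorial 12 ≤ Real.exp (c * K) := by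
    refine le_trans ?_ hexp
    rw [mul_pow]
    gcongr
  rw [neg_mul, Real.exp_neg]
  calc (n : ℝ) * (Real.exp (c * K))⁻¹
      ≤ n * (c ^ 12 * (n : ℝ) ^ 3 / Nat.factorial 12)⁻¹ := by gcongr
    _ = _ := by
      have : (Nat.factorial 12 : ℝ) ≠ 0 := by positivity
      field_simp

open Classical in
/-- The indicator that a channel state serves the set `S` of clients. -/
noncomputable def onIndicator {E : Type*} {N : ℕ} (on : Fin N → Set E) (S : Finset (Fin N)) (e : E) : ℝ :=
  if ∃ i ∈ S, e ∈ on i then 1 else 0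

lemma channelOn_eq {Ω E : Type*} {N : ℕ} (on : Fin N → Set E) (C : ℕ → Ω → E) (S : Finset (Fin N)) :
    channelOn on C S = fun t ω => onIndicator on S (C t ω) := rfl

section Collapse

variable {Ω E : Type*} [mΩ : MeasurableSpace Ω] [Fintype E] [DecidableEq E]
  {P : Measure Ω} [IsProbabilityMeasure P] {ℱ : Filtration ℕ mΩ}
  {Q : Matrix E E ℝ} {C : ℕ → Ω → E} {N : ℕ} {on : Fin N → Set E} {μ σsq : Fin N → ℝ}
  {A : ℕ → Ω → Option (Fin N)}

/-- State space collapse: the imbalances are almost surely negligible at the scale `√T`. -/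
theorem ae_tendsto_imbalance_div_sqrt (hC : IsChannelChain P ℱ Q C)
    (h_mean : ∀ S : Finset (Fin N), S.Nonempty → S ≠ Finset.univ →
      ∑ i ∈ S, μ i < temporalMean P (channelOn on C S))
    (h_total : ∑ i, μ i = temporalMean P (channelOn on C Finset.univ))
    (hμ : ∀ i, 0 ≤ μ i) (hσ : ∀ i, 0 < σsq i) (hA : IsVWD ℱ on C μ σsq A) (i : Fin N) :
    ∀ᵐ ω ∂P, Tendsto (fun T : ℕ => imbalance μ σsq A i T ω / √(T : ℝ)) atTop (𝓝 0) := by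
  obtain ⟨ω₀⟩ : Nonempty Ω := P.nonempty_of_neZero
  have : Nonempty E := ⟨C 1 ω₀⟩
  choose m h hp using fun S : Finset (Fin N) =>
    exists_poisson hC.stochastic hC.irreducible (onIndicator on S)
  have hm : ∀ S, temporalMean P (channelOn on C S) = m S := fun S =>
    HasTemporalMean.temporalMean_eq (channelOn_eq on C S ▸ hC.hasTemporalMean (hp S))
  simp only [hm] at h_mean h_total
  obtain ⟨ε, hε, hslack⟩ : ∃ ε > 0, ∀ S : Finset (Fin N), S.Nonempty → S ≠ Finset.univ →
      ∑ i ∈ S, μ i + 3 * ε ≤ m S := by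
    classical
    obtain ⟨S₀, hS₀⟩ := Finite.exists_min fun S : Finset (Fin N) =>
      if S.Nonempty ∧ S ≠ Finset.univ then m S - ∑ i ∈ S, μ i else 1
    refine ⟨(if S₀.Nonempty ∧ S₀ ≠ Finset.univ then m S₀ - ∑ i ∈ S₀, μ i else 1) / 3, ?_,
      fun S h1 h2 => ?_⟩
    · split_ifs with h3
      · have := h_mean S₀ h3.1 h3.2
        linarith
      · norm_num
    · have := hS₀ S
      rw [if_pos (show S.Nonempty ∧ S ≠ Finset.univ from ⟨h1, h2⟩)] at this
      linarith
  have hw : ∀ i, 0 < √(σsq i) := fun i => Real.sqrt_pos.2 (hσ i)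
  set L : ℝ := (1 + ∑ j, μ j) * ∑ j, (√(σsq j))⁻¹ with hLdef
  have hb : 0 ≤ 1 + ∑ j, μ j := add_nonneg zero_le_one (Finset.sum_nonneg fun j _ => hμ j)
  have hL0 : 0 ≤ L := mul_nonneg hb (Finset.sum_nonneg fun j _ => (inv_pos.2 (hw j)).le)
  have hL : ∀ i, 1 + ∑ j, μ j ≤ L * √(σsq i) := by
    intro i
    have h1 : (√(σsq i))⁻¹ ≤ ∑ j, (√(σsq j))⁻¹ :=
      Finset.single_le_sum (f := fun j => (√(σsq j))⁻¹) (fun j _ => (inv_pos.2 (hw j)).le)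
        (Finset.mem_univ i)
    have h2 := mul_le_mul_of_nonneg_right (mul_le_mul_of_nonneg_left h1 hb) (hw i).le
    rwa [mul_assoc, inv_mul_cancel₀ (hw i).ne', mul_one] at h2
  set G : ℝ := (2 * L + 2 * L ^ 2 * (∑ i, √(σsq i))) / ε with hGdef
  have hG : 2 * L + 2 * L ^ 2 * (∑ i, √(σsq i)) ≤ ε * G := (mul_div_cancel₀ _ hε.ne').ge
  set M : ℝ := (∑ i, √(σsq i)) * (G ^ 2 + 4 * L ^ 2) + 4 * L with hMdef
  have hall : ∀ᵐ ω ∂P, ∀ S : Finset (Fin N), ∀ᶠ n in atTop, ∀ s ∈ Finset.Icc 1 n,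
      |∑ t ∈ Finset.Ioc s (s + windowLength n), channelOn on C S t ω - windowLength n * m S| ≤
        ε * windowLength n :=
    ae_all_iff.2 fun S => hC.ae_eventually_window (hp S)
      (fun c hc => summable_mul_exp_neg_windowLength hc) hε
  filter_upwards [hall] with ω hω
  have hlim := tendsto_windowLength_div_sqrt.const_mul √(M / √(σsq i))
  rw [mul_zero] at hlim
  refine squeeze_zero_norm' ?_ hlim
  filter_upwards [eventually_all.2 hω, eventually_ge_atTop 1] with n hn hn1
  have hV := lyapunov_le_of_windows (ω := ω) hσ hμ hL hA hL0 hε hslack h_total hG le_rfl hn1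
    (one_le_windowLength hn1) hn
  have h1 : √(σsq i) * imbalance μ σsq A i n ω ^ 2 ≤ M * windowLength n ^ 2 :=
    (Finset.single_le_sum (f := fun i => √(σsq i) * imbalance μ σsq A i n ω ^ 2)
      (fun j _ => by positivity) (Finset.mem_univ i)).trans hV
  have h2 : |imbalance μ σsq A i n ω| ≤ √(M / √(σsq i)) * windowLength n := by
    rw [← Real.sqrt_sq (Nat.cast_nonneg (α := ℝ) (windowLength n)), ← Real.sqrt_mul' _ (sq_nonneg _)]
    refine Real.abs_le_sqrt ?_
    rw [div_mul_eq_mul_div, le_div_iff₀ (hw i)]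
    linarith
  rw [Real.norm_eq_abs, abs_div, abs_of_nonneg (Real.sqrt_nonneg _), mul_div_assoc']
  gcongr

/-- The law of a limit in distribution may be taken as the underlying probability space. -/
lemma tendstoInDistribution_id_of_map_eq {Ω' : Type*} [MeasurableSpace Ω'] {μ' : Measure Ω'}
    [IsProbabilityMeasure μ'] {X : ℕ → Ω → ℝ} {Z : Ω' → ℝ} {ν : Measure ℝ} [IsProbabilityMeasure ν]
    (h : TendstoInDistribution X atTop Z (fun _ => P) μ') (hν : μ'.map Z = ν) :
    TendstoInDistribution X atTop id (fun _ => P) ν := by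
  refine ⟨h.forall_aemeasurable, by fun_prop, ?_⟩
  have := h.tendsto
  simpa only [Measure.map_id, hν] using this

lemma integrable_sq_gaussianReal (v : NNReal) :
    Integrable (fun x : ℝ => x ^ 2) (gaussianReal 0 v) :=
  (memLp_id_gaussianReal (μ := 0) (v := v) 2).integrable_sq

lemma integral_sq_gaussianReal (v : NNReal) : ∫ x, x ^ 2 ∂gaussianReal 0 v = v := by
  have h := variance_fun_id_gaussianReal (μ := 0) (v := v)
  rw [variance_eq_integral measurable_id'.aemeasurable] at h
  simpa using h

end Collapse

end Wireless

open Wireless in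
theorem theorem4 {Ω E : Type*} [mΩ : MeasurableSpace Ω] [Fintype E] [DecidableEq E]
    (P : Measure Ω) [IsProbabilityMeasure P] (ℱ : Filtration ℕ mΩ)
    (Q : Matrix E E ℝ) (C : ℕ → Ω → E) (hC : Wireless.IsChannelChain P ℱ Q C)
    (N : ℕ) (on : Fin N → Set E) (μ σsq : Fin N → ℝ)
    (h_mean : ∀ S : Finset (Fin N), S.Nonempty → S ≠ Finset.univ →
      ∑ i ∈ S, μ i < Wireless.temporalMean P (Wireless.channelOn on C S))
    (h_total : ∑ i, μ i = Wireless.temporalMean P (Wireless.channelOn on C Finset.univ))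
    (h_var : Real.sqrt (Wireless.temporalVariance P (Wireless.channelOn on C Finset.univ)) ≤
      ∑ i, Real.sqrt (σsq i))
    (h_nonneg : ∀ i, 0 ≤ μ i) (h_pos : ∀ i, 0 < σsq i)
    (A : ℕ → Ω → Option (Fin N)) (hA : Wireless.IsVWD ℱ on C μ σsq A) :
    ∀ i : Fin N,
      Wireless.HasTemporalMean P (Wireless.delivery A i) (μ i) ∧
      ∃ v : ℝ, Wireless.HasTemporalVariance P (Wireless.delivery A i) (μ i) v ∧ v ≤ σsq i := by
  intro i
  obtain ⟨ω₀⟩ : Nonempty Ω := P.nonempty_of_neZero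
  have : Nonempty E := ⟨C 1 ω₀⟩
  obtain ⟨m, h, hp⟩ := exists_poisson hC.stochastic hC.irreducible
    (onIndicator on (Finset.univ : Finset (Fin N)))
  have hmean : HasTemporalMean P (channelOn on C Finset.univ) m :=
    channelOn_eq on C Finset.univ ▸ hC.hasTemporalMean hp
  have hm : temporalMean P (channelOn on C Finset.univ) = m := hmean.temporalMean_eq
  have hp' := sum_mul_sub_add_of_poisson hC.stochastic hp
  obtain ⟨v, hv⟩ := hC.exists_tendstoInDistribution hp'
  have hsum : ∀ (T : ℕ) (ω : Ω), ∑ r ∈ Finset.Icc 1 T, (onIndicator on Finset.univ (C r ω) - m) =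
      ∑ t ∈ Finset.Icc 1 T, channelOn on C Finset.univ t ω - T * m := by
    intro T ω
    rw [Finset.sum_sub_distrib]
    simp [channelOn_eq]
  simp only [hsum] at hv
  have hvar : temporalVariance P (channelOn on C Finset.univ) = v := by
    refine HasTemporalVariance.temporalVariance_eq ?_
    rw [hm]
    exact ⟨gaussianReal 0 v, inferInstance, hv, integrable_sq_gaussianReal v,
      integral_sq_gaussianReal v⟩
  rw [hvar] at h_var
  have hcollapse := ae_tendsto_imbalance_div_sqrt hC h_mean h_total h_nonneg h_pos hA i
  rw [hm] at h_total
  have hw : 0 < √(σsq i) := Real.sqrt_pos.2 (h_pos i)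
  set W : ℝ := ∑ j, √(σsq j) with hWdef
  have hW : 0 < W := Finset.sum_pos (fun j _ => Real.sqrt_pos.2 (h_pos j)) ⟨i, Finset.mem_univ i⟩
  set c : ℝ := √(σsq i) / W with hc
  have hident : ∀ (T : ℕ) (ω : Ω), ∑ t ∈ Finset.Icc 1 T, delivery A i t ω - T * μ i =
      c * (∑ t ∈ Finset.Icc 1 T, channelOn on C Finset.univ t ω - T * m) -
        √(σsq i) * imbalance μ σsq A i T ω := by
    intro T ω
    rw [sum_delivery_sub_eq h_pos hA, h_total]
  refine ⟨?_, ?_⟩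
  · filter_upwards [hmean, hcollapse] with ω h1 h2
    have h3 : Tendsto (fun T : ℕ => (√(T : ℝ))⁻¹) atTop (𝓝 0) :=
      (Real.tendsto_sqrt_atTop.comp tendsto_natCast_atTop_atTop).inv_tendsto_atTop
    have h4 := ((h1.sub_const m).const_mul c).sub ((h2.mul h3).const_mul √(σsq i))
    have h5 := h4.add_const (μ i)
    simp only [sub_self, mul_zero, zero_add] at h5
    refine h5.congr' ?_
    filter_upwards [eventually_gt_atTop 0] with T hT
    have hT0 : (0 : ℝ) < T := by exact_mod_cast hT
    have h6 := hident T ω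
    have h7 : imbalance μ σsq A i T ω / √(T : ℝ) * (√(T : ℝ))⁻¹ = imbalance μ σsq A i T ω / T := by
      rw [← div_eq_mul_inv, div_div, Real.mul_self_sqrt hT0.le]
    rw [h7, eq_div_iff hT0.ne']
    field_simp
    linarith
  · have hZm : ∀ T : ℕ, Measurable fun ω => ∑ t ∈ Finset.Icc 1 T, delivery A i t ω := fun T =>
      Finset.measurable_fun_sum _ fun t ht => Measurable.ite
        (ℱ.le t _ (hA.adapted t (Finset.mem_Icc.1 ht).1 i)) measurable_const measurable_const
    have hY : ∀ T : ℕ, AEMeasurable (fun ω =>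
        (∑ t ∈ Finset.Icc 1 T, delivery A i t ω - T * μ i) / √(T : ℝ)) P := fun T =>
      (((hZm T).sub_const _).div_const _).aemeasurable
    have hX := hv.continuous_comp (g := fun x => c * x) (by fun_prop)
    have hX' := tendstoInDistribution_id_of_map_eq (ν := gaussianReal 0 (⟨c ^ 2, sq_nonneg c⟩ * v)) hX (by
      have := gaussianReal_map_const_mul (μ := 0) (v := v) c
      rw [mul_zero] at this
      exact this)
    refine ⟨c ^ 2 * v, ⟨gaussianReal 0 (⟨c ^ 2, sq_nonneg c⟩ * v), inferInstance, ?_,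
      integrable_sq_gaussianReal _, integral_sq_gaussianReal _⟩, ?_⟩
    · refine tendstoInDistribution_of_tendstoInMeasure_sub _ _ hX' ?_ hY
      refine tendstoInMeasure_of_tendsto_ae
        (fun T => ((hY T).sub (hX.forall_aemeasurable T)).aestronglyMeasurable) ?_
      filter_upwards [hcollapse] with ω hω
      have h1 := hω.const_mul (-√(σsq i))
      rw [mul_zero] at h1
      refine h1.congr fun T => ?_
      simp only [Pi.sub_apply, Function.comp_apply, hident]
      ring
    · have h1 : (v : ℝ) ≤ W ^ 2 := by
        rw [← Real.sqrt_le_left hW.le]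
        exact h_var
      calc c ^ 2 * (v : ℝ) ≤ c ^ 2 * W ^ 2 := by gcongr
        _ = √(σsq i) ^ 2 := by
          rw [hc]
          field_simp
        _ = σsq i := Real.sq_sqrt (h_pos i).le
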